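/- **Setting.** Let $Y = XB^* + C^* + \mathcal E$ with $X\in\mathbb R^{n\times p}$, $B^*\in\mathbb R^{p\times m}$, $C^*\in\mathbb R^{n\times m}$ deterministic, where the noise matrix $\mathcal E$ is sub-Gaussian with scale $\sigma>0$, i.e. $\mathbb E\exp(\langle \mathcal E,A\rangle)\le \exp(\sigma^2\|A\|_F^2/2)$ for all $A\in\mathbb R^{n\times m}$ (for example, i.i.d. $N(0,\sigma^2)$ entries). Write $q=\operatorname{rank}X$, $r^*=\operatorname{rank}B^*\ge 1$, $J(C)$ for the number of nonzero rows of $C$, $J^*=J(C^*)$, and $M(B,C)=\|XB+C\|_F^2$. Let $r=(1+\alpha)r^*$ be an integer, $\alpha\ge0$. A threshold function $\Theta(t;\lambda)$ ($t\in\mathbb R$, $\lambda\ge0$) is odd and nondecreasing in $t$, tends to $\infty$ as $t\to\infty$, and satisfies $0\le\Theta(t;\lambda)\le t$ for $t\ge0$. Put $\Theta^{-1}(u;\lambda)=\sup\{t:\Theta(t;\lambda)\le u\}$, $P_\Theta(t;\lambda)=\int_0^{|t|}\{\Theta^{-1}(u;\lambda)-u\}\,du$ and $\mathcal L_\Theta=1-\operatorname{ess\,inf}\{d\Theta^{-1}(u;\lambda)/du:u\ge0\}$.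 Let $\vec\Theta$ act on matrices row by row, $\vec\Theta(a;\lambda)=a\,\Theta(\|a\|_2;\lambda)/\|a\|_2$ for $a\ne0$ and $\vec\Theta(0;\lambda)=0$. Let $P_H(t;\lambda)=-t^2/2+\lambda|t|$ for $|t|<\lambda$ and $P_H(t;\lambda)=\lambda^2/2$ otherwise. For $C$ with rows $c_i$ put $P_{2,\Theta}(C;\lambda)=\sum_iP_\Theta(\|c_i\|_2;\lambda)$, $P_{2,H}(C;\lambda)=\sum_iP_H(\|c_i\|_2;\lambda)$ and $P_{2,0}(C;\lambda)=(\lambda^2/2)J(C)$. Let $\mathcal R(X,Z,r)=(X^TX)^-X^TZ\,VV^T$, where $^-$ is the Moore–Penrose inverse and the columns of $V$ are leading $r$ orthonormal eigenvectors of $Z^TX(X^TX)^-X^TZ$ (any choice in case of ties). **Theorem 8.** Let $\lambda=A\sigma(m+\log n)^{1/2}$, and let $\Theta$ be a threshold function associated with a bounded nonconvex penalty $P$ with constant $K>0$: $P(t;\lambda)-P(0;\lambda)=P_\Theta(t;\lambda)+q(t;\lambda)$ for some $q(\cdot;\lambda)\ge0$ with $q(\Theta(s;\lambda);\lambda)=0$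 for all $s\in\mathbb R$, $P(0;\lambda)=0$, and $P_H(t;\lambda)\le P(t;\lambda)\le K\lambda^2$ for all $t$. Let $(\hat B,\hat C)$ be a random pair which almost surely is a fixed point of the alternating algorithm, $$\hat B=\mathcal R(X,Y-\hat C,r),\qquad \hat C=\vec\Theta(Y-X\hat B;\lambda),$$ with $\operatorname{rank}\hat B=r$ and $\vec\Theta(\cdot;\lambda)$ continuous at $Y-X\hat B$. Let $\delta>0$, $\vartheta>0$, $\zeta\ge0$ be constants and assume that almost surely the regularity inequality $$(1+\alpha)^{-1/2}\|XB-XB^*\|_F^2+\mathcal L_\Theta\|C-C^*\|_F^2+\vartheta P_{2,H}(C-C^*;\lambda)\le(2-\delta)M(B-B^*,C-C^*)+2P_{2,\Theta}(C;\lambda)+\zeta P_{2,0}(C^*;\lambda)$$ holds at $(B,C)=(\hat B,\hat C)$. Then there is $A_0$ depending only on $(\delta,\vartheta)$ such that, whenever $A\ge A_0$, $M(\hat B-B^*,\hat C-C^*)$ is integrable and $$\mathbb E\,M(\hat B-B^*,\hat C-C^*)\le c\,\big\{\sigma^2(1+\alpha)(q+m)r^*+\sigma^2J^*m+\sigma^2J^*\log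 n\big\},$$ where $c$ depends only on $(A,K,\delta,\vartheta,\zeta)$. -/

import Mathlib

open MeasureTheory ProbabilityTheory
open scoped NNReal Matrix

namespace RobustRRR

noncomputable section

/-! ### Norms, row supports and the prediction error -/

/-- Euclidean norm of the `i`-th row. -/
def rowNorm {n m : ℕ} (A : Matrix (Fin n) (Fin m) ℝ) (i : Fin n) : ℝ :=
  Real.sqrt (∑ j, A i j ^ 2)

/-- Squared Frobenius norm. -/
def frobSq {n m : ℕ} (A : Matrix (Fin n) (Fin m) ℝ) : ℝ :=
  ∑ i, ∑ j, A i j ^ 2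

/-- Frobenius inner product. -/
def frobInner {n m : ℕ} (A B : Matrix (Fin n) (Fin m) ℝ) : ℝ :=
  ∑ i, ∑ j, A i j * B i j

open Classical in
/-- `J(C)`: the number of nonzero rows of `C`. -/
def numNonzeroRows {n m : ℕ} (C : Matrix (Fin n) (Fin m) ℝ) : ℕ :=
  (Finset.univ.filter fun i : Fin n => C i ≠ 0).card

/-- `M(B, C) = ‖X B + C‖_F²`. -/
def predError {n p m : ℕ} (X : Matrix (Fin n) (Fin p) ℝ)
    (B : Matrix (Fin p) (Fin m) ℝ) (C : Matrix (Fin n) (Fin m) ℝ) : ℝ :=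
  frobSq (X * B + C)

/-! ### Threshold functions, penalties -/

/-- Threshold functions `Θ(t; λ)`, `t ∈ ℝ`, `λ ≥ 0` (first argument `t`, second argument `λ`). -/
structure IsThreshold (Θ : ℝ → ℝ → ℝ) : Prop where
  odd : ∀ lam, 0 ≤ lam → ∀ t, Θ (-t) lam = -Θ t lam
  mono : ∀ lam, 0 ≤ lam → ∀ t t', t ≤ t' → Θ t lam ≤ Θ t' lam
  tendsto : ∀ lam, 0 ≤ lam →
    Filter.Tendsto (fun t => Θ t lam) Filter.atTop Filter.atTop
  bounds : ∀ lam, 0 ≤ lam → ∀ t, 0 ≤ t → 0 ≤ Θ t lam ∧ Θ t lam ≤ t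

/-- The multivariate threshold function, applied to each row: a row `a ≠ 0` is mapped to
`a Θ(‖a‖; λ) / ‖a‖` and a zero row to the zero row. -/
def multiThreshold {n m : ℕ} (Θ : ℝ → ℝ → ℝ) (lam : ℝ)
    (A : Matrix (Fin n) (Fin m) ℝ) : Matrix (Fin n) (Fin m) ℝ :=
  Matrix.of fun i j => A i j * (Θ (rowNorm A i) lam / rowNorm A i)

/-- `Θ⁻¹(u; λ) = sup {t : Θ(t; λ) ≤ u}`. -/
def thetaInv (Θ : ℝ → ℝ → ℝ) (lam u : ℝ) : ℝ :=
  sSup {t : ℝ | Θ t lam ≤ u}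

/-- `P_Θ(t; λ) = ∫_0^{|t|} (Θ⁻¹(u; λ) - u) du`. -/
def penTheta (Θ : ℝ → ℝ → ℝ) (t lam : ℝ) : ℝ :=
  ∫ u in (0 : ℝ)..|t|, (thetaInv Θ lam u - u)

/-- `L_Θ = 1 - ess inf {dΘ⁻¹(u; λ)/du : u ≥ 0}`. -/
def lossTheta (Θ : ℝ → ℝ → ℝ) (lam : ℝ) : ℝ :=
  1 - essInf (fun u : ℝ => deriv (thetaInv Θ lam) u) (volume.restrict (Set.Ici (0 : ℝ)))

/-- The hard-thresholding penalty `P_H(t; λ)`. -/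
def penH (t lam : ℝ) : ℝ :=
  if |t| < lam then -t ^ 2 / 2 + lam * |t| else lam ^ 2 / 2

/-- `P_{2,H}(C; λ) = ∑ᵢ P_H(‖cᵢ‖₂; λ)`. -/
def pen2H {n m : ℕ} (C : Matrix (Fin n) (Fin m) ℝ) (lam : ℝ) : ℝ :=
  ∑ i, penH (rowNorm C i) lam

/-- `P_{2,0}(C; λ) = ∑ᵢ (λ²/2) 1{cᵢ ≠ 0} = (λ²/2) J(C)`. -/
def pen20 {n m : ℕ} (C : Matrix (Fin n) (Fin m) ℝ) (lam : ℝ) : ℝ :=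
  lam ^ 2 / 2 * numNonzeroRows C

/-- `P_{2,Θ}(C; λ) = ∑ᵢ P_Θ(‖cᵢ‖₂; λ)`. -/
def pen2Theta {n m : ℕ} (Θ : ℝ → ℝ → ℝ) (C : Matrix (Fin n) (Fin m) ℝ) (lam : ℝ) : ℝ :=
  ∑ i, penTheta Θ (rowNorm C i) lam

/-- The penalty `P(·; λ)` is associated with `Θ(·; λ)`:
`P(t; λ) - P(0; λ) = P_Θ(t; λ) + q(t; λ)` for some `q(·; λ) ≥ 0` vanishing on the range of
`Θ(·; λ)`. -/
def IsAssociatedPenalty (Θ P : ℝ → ℝ → ℝ) (lam : ℝ) : Prop :=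
  ∃ q : ℝ → ℝ, (∀ t, 0 ≤ q t) ∧ (∀ s, q (Θ s lam) = 0) ∧
    ∀ t, P t lam - P 0 lam = penTheta Θ t lam + q t

/-- `P(·; λ)` is a bounded nonconvex penalty with threshold `λ` and constant `K`:
`P(0; λ) = 0` and `P_H(t; λ) ≤ P(t; λ) ≤ K λ²` for all `t`. -/
def IsBoundedPenalty (P : ℝ → ℝ → ℝ) (K lam : ℝ) : Prop :=
  P 0 lam = 0 ∧ ∀ t, penH t lam ≤ P t lam ∧ P t lam ≤ K * lam ^ 2

/-! ### Reduced-rank regression and the fixed points of the algorithm -/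

/-- `G` is the Moore–Penrose pseudoinverse of `A`. -/
structure IsMoorePenrose {k l : ℕ} (A : Matrix (Fin k) (Fin l) ℝ)
    (G : Matrix (Fin l) (Fin k) ℝ) : Prop where
  mul_mul_self : A * G * A = A
  self_mul_mul : G * A * G = G
  symm_left : (A * G)ᵀ = A * G
  symm_right : (G * A)ᵀ = G * A

/-- The columns of `V` are leading `r` orthonormal eigenvectors of the symmetric matrix `S`: the
first `r` columns of an orthogonal matrix of eigenvectors, with eigenvalues in decreasing order. -/
def IsLeadingEigenvectors {m r : ℕ} (S : Matrix (Fin m) (Fin m) ℝ)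
    (V : Matrix (Fin m) (Fin r) ℝ) : Prop :=
  ∃ (h : r ≤ m) (U : Matrix (Fin m) (Fin m) ℝ) (d : Fin m → ℝ),
    Uᵀ * U = 1 ∧ Antitone d ∧ S * U = U * Matrix.diagonal d ∧
      V = U.submatrix id (Fin.castLE h)

/-- `B = R(X, Y, r) = (XᵀX)⁻ Xᵀ Y V Vᵀ`, with `V` formed by leading `r` eigenvectors of
`Yᵀ P_X Y`, `P_X = X (XᵀX)⁻ Xᵀ`. A relation, since `V` is not unique when eigenvalues are tied. -/
def IsReducedRankRegression {n p m : ℕ} (X : Matrix (Fin n) (Fin p) ℝ)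
    (Y : Matrix (Fin n) (Fin m) ℝ) (r : ℕ) (B : Matrix (Fin p) (Fin m) ℝ) : Prop :=
  ∃ (G : Matrix (Fin p) (Fin p) ℝ) (V : Matrix (Fin m) (Fin r) ℝ),
    IsMoorePenrose (Xᵀ * X) G ∧
    IsLeadingEigenvectors (Yᵀ * (X * G * Xᵀ) * Y) V ∧
    B = G * Xᵀ * Y * (V * Vᵀ)

/-- `(B, C)` is a fixed point of the alternating algorithm:
`B = R(X, Y - C, r)` and `C = Θ⃗(Y - X B; λ)`. -/
def IsFixedPoint {n p m : ℕ} (Θ : ℝ → ℝ → ℝ) (lam : ℝ) (X : Matrix (Fin n) (Fin p) ℝ)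
    (Y : Matrix (Fin n) (Fin m) ℝ) (r : ℕ)
    (B : Matrix (Fin p) (Fin m) ℝ) (C : Matrix (Fin n) (Fin m) ℝ) : Prop :=
  IsReducedRankRegression X (Y - C) r B ∧ C = multiThreshold Θ lam (Y - X * B)

/-- The regularity inequality at the pair `(B, C)`. -/
def RegularityIneq {n p m : ℕ} (Θ : ℝ → ℝ → ℝ) (lam α δ ϑ ζ : ℝ)
    (X : Matrix (Fin n) (Fin p) ℝ)
    (Bstar : Matrix (Fin p) (Fin m) ℝ) (Cstar : Matrix (Fin n) (Fin m) ℝ)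
    (B : Matrix (Fin p) (Fin m) ℝ) (C : Matrix (Fin n) (Fin m) ℝ) : Prop :=
  (1 + α) ^ (-(1 / 2) : ℝ) * frobSq (X * B - X * Bstar)
      + lossTheta Θ lam * frobSq (C - Cstar) + ϑ * pen2H (C - Cstar) lam
    ≤ (2 - δ) * predError X (B - Bstar) (C - Cstar)
      + 2 * pen2Theta Θ C lam + ζ * pen20 Cstar lam

/-! ### Noise -/

/-- The random matrix `E` (as a vector in `ℝ^{n×m}`) is centred sub-Gaussian with scale `σ`:
`𝔼 exp(t ⟨E, A⟩) ≤ exp(σ² ‖A‖_F² t² / 2)` for every matrix `A` and every real `t`. -/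
def IsSubGaussianNoise {Ω : Type*} [MeasurableSpace Ω] (μ : Measure Ω) {n m : ℕ}
    (E : Ω → Matrix (Fin n) (Fin m) ℝ) (σ : ℝ≥0) : Prop :=
  ∀ A : Matrix (Fin n) (Fin m) ℝ,
    HasSubgaussianMGF (fun ω => frobInner (E ω) A) (σ ^ 2 * (frobSq A).toNNReal) μ

/-- Independent `N(0, σ²)` entries form sub-Gaussian noise with scale `σ`. -/
theorem isSubGaussianNoise_of_gaussian {Ω : Type*} [MeasurableSpace Ω] (μ : Measure Ω)
    [IsProbabilityMeasure μ] {n m : ℕ} (E : Ω → Matrix (Fin n) (Fin m) ℝ) (σ : ℝ≥0)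
    (hmeas : ∀ i j, AEMeasurable (fun ω => E ω i j) μ)
    (hlaw : ∀ i j, μ.map (fun ω => E ω i j) = gaussianReal 0 (σ ^ 2))
    (hind : iIndepFun (fun (ij : Fin n × Fin m) ω => E ω ij.1 ij.2) μ) :
    IsSubGaussianNoise μ E σ := by
  intro A
  have h1 : ∀ ij ∈ (Finset.univ : Finset (Fin n × Fin m)),
      HasSubgaussianMGF (fun ω => A ij.1 ij.2 * E ω ij.1 ij.2)
        ((A ij.1 ij.2 ^ 2).toNNReal * σ ^ 2) μ := by
    intro ij _
    have h0 : HasSubgaussianMGF (fun ω => E ω ij.1 ij.2) (σ ^ 2) μ := by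
      refine ⟨fun t => ?_, fun t => ?_⟩
      · have := integrable_exp_mul_gaussianReal (μ := 0) (v := σ ^ 2) t
        rw [← hlaw ij.1 ij.2] at this
        exact (integrable_map_measure this.1 (hmeas _ _)).1 this
      · rw [mgf_gaussianReal (hlaw ij.1 ij.2)]
        simp
    rw [Real.toNNReal_of_nonneg (sq_nonneg _)]
    exact h0.const_mul (A ij.1 ij.2)
  have h2 : iIndepFun (fun (ij : Fin n × Fin m) ω => A ij.1 ij.2 * E ω ij.1 ij.2) μ :=
    hind.comp (fun ij x => A ij.1 ij.2 * x) (fun ij => measurable_const_mul _)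
  have h3 := HasSubgaussianMGF.sum_of_iIndepFun h2 h1
  have hc : (∑ ij : Fin n × Fin m, (A ij.1 ij.2 ^ 2).toNNReal * σ ^ 2)
      = σ ^ 2 * (frobSq A).toNNReal := by
    rw [← Finset.sum_mul, mul_comm, ← Real.toNNReal_sum_of_nonneg fun _ _ => sq_nonneg _,
      Fintype.sum_prod_type]
    rfl
  have hf : (fun ω => ∑ ij : Fin n × Fin m, A ij.1 ij.2 * E ω ij.1 ij.2)
      = fun ω => frobInner (E ω) A := by
    funext ω
    rw [Fintype.sum_prod_type]
    simp only [frobInner, mul_comm]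
  rw [← hc, ← hf]
  exact h3

end

end RobustRRR

open RobustRRR

namespace RobustRRR

/-! ### Frobenius inner product -/

section Frobenius

variable {n m k : ℕ}

/-! Write `S = X(B̂ - B*)`, `T = Ĉ - C*`, `M = ‖S + T‖²`. Each half of the fixed-point equation
yields a comparison with the truth, and the regularity inequality is shaped to absorb what the two
comparisons leave over.

Low-rank half: in the eigenbasis used by the estimator, the projected response has orthogonal
columns and `X B̂` keeps the `r` longest. A competitor of rank `r*` can capture only a limited
amount of the discarded columns, and the surplus `r = (1 + α) r*` weakens its pull by the factor `(1
+ α)^(-1/2)`: `2⟨Y - Ĉ - XB̂, XB* - XB̂⟩ ≤ (1 + α)^(-1/2) ‖S‖²`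
(`IsReducedRankRegression.two_mul_frobInner_le`). Thresholding half: `Θ⁻¹` is the derivative of
`P_Θ(t) + t²/2` and grows at rate at least `1 - L_Θ`, so `Ĉ` minimizes its penalized criterion with
curvature `1 - L_Θ` (`multiThreshold_optimality`). Adding both to the regularity inequality cancels
all quadratic terms except `δ M` and leaves `ϑ P_H(T)` to spare (`fixedPoint_basic_inequality`).

It remains to bound `2⟨E, S + T⟩` uniformly by `(δ/2) M + ϑ P_H(T) + R` with `R` of small
expectation. Let `I` be the set of rows of `T` of norm at least `λ`. Rows outside `I` are handled
one at a time. On `I` the noise energy is about `|I| σ² (m + log n)`, which is paid by `P_H = λ²/2`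
per row. The rest, `S` with the rows in `I` deleted, splits into a part in the column space of `X`,
controlled by rank times squared operator norm, and a part in a fixed space of dimension at most
`|I|`, again paid by the penalty (`two_mul_frobInner_noise_le`).

Expectations come from exponential moments. Squared norms of sub-Gaussian matrices are handled by
Gaussian decoupling, the operator norm by averaging a convex function over a ball, and the union
over all `I` costs only a constant because the choice of `λ` makes the excess for `I` at most of
order `n^(-|I|)`. -/

theorem frobInner_eq_trace (A B : Matrix (Fin n) (Fin m) ℝ) :
    frobInner A B = (Aᵀ * B).trace := by
  simp only [frobInner, Matrix.trace, Matrix.diag, Matrix.mul_apply, Matrix.transpose_apply]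
  exact Finset.sum_comm

theorem frobInner_self (A : Matrix (Fin n) (Fin m) ℝ) : frobInner A A = frobSq A := by
  simp only [frobInner, frobSq, sq]

theorem frobInner_comm (A B : Matrix (Fin n) (Fin m) ℝ) : frobInner A B = frobInner B A := by
  simp only [frobInner, mul_comm]

theorem frobInner_add_left (A A' B : Matrix (Fin n) (Fin m) ℝ) :
    frobInner (A + A') B = frobInner A B + frobInner A' B := by
  simp [frobInner, add_mul, Finset.sum_add_distrib]

theorem frobInner_add_right (A B B' : Matrix (Fin n) (Fin m) ℝ) :
    frobInner A (B + B') = frobInner A B + frobInner A B' := by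
  simp [frobInner, mul_add, Finset.sum_add_distrib]

theorem frobInner_sub_left (A A' B : Matrix (Fin n) (Fin m) ℝ) :
    frobInner (A - A') B = frobInner A B - frobInner A' B := by
  simp [frobInner, sub_mul, Finset.sum_sub_distrib]

theorem frobInner_sub_right (A B B' : Matrix (Fin n) (Fin m) ℝ) :
    frobInner A (B - B') = frobInner A B - frobInner A B' := by
  simp [frobInner, mul_sub, Finset.sum_sub_distrib]

theorem frobInner_smul_left (c : ℝ) (A B : Matrix (Fin n) (Fin m) ℝ) :
    frobInner (c • A) B = c * frobInner A B := by
  simp [frobInner, mul_assoc, Finset.mul_sum]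

theorem frobInner_smul_right (c : ℝ) (A B : Matrix (Fin n) (Fin m) ℝ) :
    frobInner A (c • B) = c * frobInner A B := by
  simp [frobInner, mul_left_comm, Finset.mul_sum]

theorem frobInner_mul_left (L : Matrix (Fin k) (Fin n) ℝ) (A : Matrix (Fin n) (Fin m) ℝ)
    (B : Matrix (Fin k) (Fin m) ℝ) : frobInner (L * A) B = frobInner A (Lᵀ * B) := by
  rw [frobInner_eq_trace, frobInner_eq_trace, Matrix.transpose_mul, Matrix.mul_assoc]

theorem frobInner_mul_right (A : Matrix (Fin n) (Fin m) ℝ) (R : Matrix (Fin m) (Fin k) ℝ)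
    (B : Matrix (Fin n) (Fin k) ℝ) : frobInner (A * R) B = frobInner A (B * Rᵀ) := by
  rw [frobInner_eq_trace, frobInner_eq_trace, Matrix.transpose_mul, Matrix.mul_assoc,
    Matrix.trace_mul_comm, Matrix.mul_assoc]

theorem frobSq_nonneg (A : Matrix (Fin n) (Fin m) ℝ) : 0 ≤ frobSq A :=
  Finset.sum_nonneg fun _ _ => Finset.sum_nonneg fun _ _ => sq_nonneg _

theorem frobSq_add (A B : Matrix (Fin n) (Fin m) ℝ) :
    frobSq (A + B) = frobSq A + 2 * frobInner A B + frobSq B := by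
  rw [← frobInner_self, frobInner_add_left, frobInner_add_right, frobInner_add_right,
    frobInner_comm B A, frobInner_self, frobInner_self]
  ring

theorem frobSq_sub (A B : Matrix (Fin n) (Fin m) ℝ) :
    frobSq (A - B) = frobSq A - 2 * frobInner A B + frobSq B := by
  rw [← frobInner_self, frobInner_sub_left, frobInner_sub_right, frobInner_sub_right,
    frobInner_comm B A, frobInner_self, frobInner_self]
  ring

theorem frobSq_smul (c : ℝ) (A : Matrix (Fin n) (Fin m) ℝ) :
    frobSq (c • A) = c ^ 2 * frobSq A := by
  rw [← frobInner_self, frobInner_smul_left, frobInner_smul_right, frobInner_self]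
  ring

theorem frobSq_neg (A : Matrix (Fin n) (Fin m) ℝ) : frobSq (-A) = frobSq A := by
  simp [frobSq]

theorem frobSq_transpose (A : Matrix (Fin n) (Fin m) ℝ) : frobSq Aᵀ = frobSq A := by
  simp only [frobSq, Matrix.transpose_apply]
  exact Finset.sum_comm

theorem frobSq_eq_sum_rowNorm (A : Matrix (Fin n) (Fin m) ℝ) :
    frobSq A = ∑ i, rowNorm A i ^ 2 := by
  refine Finset.sum_congr rfl fun i _ => ?_
  rw [rowNorm, Real.sq_sqrt (Finset.sum_nonneg fun _ _ => sq_nonneg _)]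

/-- Young's inequality for the Frobenius inner product. -/
theorem two_mul_frobInner_le {a : ℝ} (ha : 0 < a) (A B : Matrix (Fin n) (Fin m) ℝ) :
    2 * frobInner A B ≤ a⁻¹ * frobSq A + a * frobSq B := by
  have h := frobSq_nonneg (A - a • B)
  rw [frobSq_sub, frobInner_smul_right, frobSq_smul] at h
  have h2 : a⁻¹ * (frobSq A - 2 * (a * frobInner A B) + a ^ 2 * frobSq B)
      = a⁻¹ * frobSq A - 2 * frobInner A B + a * frobSq B := by
    field_simp
  have := mul_nonneg (inv_nonneg.2 ha.le) h
  linarith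

/-- The columns of a suitable matrix form an orthonormal basis of the column space of `A`. -/
theorem exists_orthonormal_basis_columns (A : Matrix (Fin n) (Fin k) ℝ) {q : ℕ}
    (hq : A.rank = q) :
    ∃ b : Matrix (Fin n) (Fin q) ℝ, bᵀ * b = 1 ∧ b * (bᵀ * A) = A := by
  set S : Submodule ℝ (EuclideanSpace ℝ (Fin n)) := LinearMap.range (Matrix.toEuclideanLin A)
    with hS
  have hrank : Module.finrank ℝ S = q := by
    rw [← hq, Matrix.rank_eq_finrank_range_toLin A (EuclideanSpace.basisFun (Fin n) ℝ).toBasis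
      (EuclideanSpace.basisFun (Fin k) ℝ).toBasis]
    rfl
  let e : OrthonormalBasis (Fin q) ℝ S :=
    (stdOrthonormalBasis ℝ S).reindex (finCongr hrank)
  refine ⟨Matrix.of fun i l => (e l : EuclideanSpace ℝ (Fin n)) i, ?_, ?_⟩
  · ext i j
    have := orthonormal_iff_ite.1 e.orthonormal i j
    rw [Submodule.coe_inner, PiLp.inner_apply] at this
    simp only [Matrix.mul_apply, Matrix.transpose_apply, Matrix.of_apply, Matrix.one_apply]
    rw [← this]
    refine Finset.sum_congr rfl fun x _ => ?_
    simp [mul_comm]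
  · ext i j
    let v : S := ⟨Matrix.toEuclideanLin A (EuclideanSpace.single j 1), LinearMap.mem_range_self _ _⟩
    have hv : ∀ x, (v : EuclideanSpace ℝ (Fin n)) x = A x j := by
      intro x
      simp [v]
    have h := congrArg (fun w : S => (w : EuclideanSpace ℝ (Fin n)) i) (e.sum_repr v)
    simp only [hv] at h
    rw [← h]
    simp only [Matrix.mul_apply, Matrix.transpose_apply, Matrix.of_apply]
    have hr : ∀ l, e.repr v l = ∑ x, (e l : EuclideanSpace ℝ (Fin n)) x * A x j := by
      intro l
      rw [e.repr_apply_apply, Submodule.coe_inner, PiLp.inner_apply]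
      refine Finset.sum_congr rfl fun x _ => ?_
      rw [hv]
      simp [mul_comm]
    simp only [← hr]
    rw [Submodule.coe_sum, WithLp.ofLp_sum, Finset.sum_apply]
    exact Finset.sum_congr rfl fun l _ => mul_comm _ _

/-- The rows of a suitable matrix span the row space of `A`. -/
theorem exists_orthonormal_basis_rows (A : Matrix (Fin n) (Fin k) ℝ) {q : ℕ}
    (hq : A.rank = q) :
    ∃ b : Matrix (Fin k) (Fin q) ℝ, bᵀ * b = 1 ∧ A * b * bᵀ = A := by
  obtain ⟨b, hb, hA⟩ := exists_orthonormal_basis_columns Aᵀ (A.rank_transpose.trans hq)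
  refine ⟨b, hb, ?_⟩
  have h := congrArg Matrix.transpose hA
  rwa [Matrix.transpose_mul, Matrix.transpose_mul, Matrix.transpose_transpose,
    Matrix.transpose_transpose] at h

theorem frobSq_transpose_mul_le {b : Matrix (Fin n) (Fin k) ℝ} (hb : bᵀ * b = 1)
    (A : Matrix (Fin n) (Fin m) ℝ) : frobSq (bᵀ * A) ≤ frobSq A := by
  have h := frobSq_nonneg (A - b * (bᵀ * A))
  have h1 : frobInner A (b * (bᵀ * A)) = frobSq (bᵀ * A) := by
    rw [frobInner_comm, frobInner_mul_left, frobInner_self]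
  have h2 : frobSq (b * (bᵀ * A)) = frobSq (bᵀ * A) := by
    rw [← frobInner_self, frobInner_mul_left, ← Matrix.mul_assoc, hb, Matrix.one_mul,
      frobInner_self]
  rw [frobSq_sub, h1, h2] at h
  linarith

theorem frobSq_mul_orthonormal_le {b : Matrix (Fin m) (Fin k) ℝ} (hb : bᵀ * b = 1)
    (A : Matrix (Fin n) (Fin m) ℝ) : frobSq (A * b) ≤ frobSq A := by
  have h := frobSq_transpose_mul_le hb Aᵀ
  rwa [← Matrix.transpose_mul, frobSq_transpose, frobSq_transpose] at h

theorem frobSq_mul_orthogonal {U : Matrix (Fin m) (Fin m) ℝ} (hU : U * Uᵀ = 1)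
    (A : Matrix (Fin n) (Fin m) ℝ) : frobSq (A * U) = frobSq A := by
  rw [← frobInner_self, frobInner_mul_right, Matrix.mul_assoc, hU, Matrix.mul_one, frobInner_self]

theorem frobInner_mul_orthogonal {U : Matrix (Fin m) (Fin m) ℝ} (hU : U * Uᵀ = 1)
    (A B : Matrix (Fin n) (Fin m) ℝ) : frobInner (A * U) (B * U) = frobInner A B := by
  rw [frobInner_mul_right, Matrix.mul_assoc, hU, Matrix.mul_one]

end Frobenius

end RobustRRR
namespace RobustRRR

/-! ### Reduced-rank regression -/

section ReducedRank

variable {n m k p : ℕ}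

theorem frobSq_orthonormal {b : Matrix (Fin m) (Fin k) ℝ} (hb : bᵀ * b = 1) : frobSq b = k := by
  rw [← frobInner_self, frobInner_eq_trace, hb, Matrix.trace_one, Fintype.card_fin]

theorem sum_sq_row_orthonormal_le_one {b : Matrix (Fin m) (Fin k) ℝ} (hb : bᵀ * b = 1)
    (i : Fin m) : ∑ l, b i l ^ 2 ≤ 1 := by
  have h := frobSq_mul_orthonormal_le (n := 1) hb
    (Matrix.of fun _ j => if j = i then (1 : ℝ) else 0)
  simpa [frobSq, Matrix.mul_apply] using h

theorem sum_ite_val_lt {r : ℕ} (hr : r ≤ m) :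
    ∑ i : Fin m, (if (i : ℕ) < r then (1 : ℝ) else 0) = r := by
  rw [Fin.sum_univ_eq_sum_range (fun i => if i < r then (1 : ℝ) else 0), Finset.sum_ite,
    Finset.sum_const_zero, add_zero, Finset.sum_const, nsmul_eq_mul, mul_one]
  congr 1
  rw [show (Finset.range m).filter (· < r) = Finset.range r by
    ext x; simp only [Finset.mem_filter, Finset.mem_range]; omega, Finset.card_range]

/-- A transport argument with pivot `s = d_{r-1}`. Leading weights are at most 1 and the other `d i`
are at most `s`, so the left side exceeds `∑_{i<r} (d i - s)` by at most `s c² ∑ w i ≤ s c² r₀ = s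
r`, exactly the amount subtracted. -/
theorem sum_weighted_le_sum_leading {d w : Fin m → ℝ} (hd : Antitone d) (hd0 : ∀ i, 0 ≤ d i)
    (hw0 : ∀ i, 0 ≤ w i) (hw1 : ∀ i, w i ≤ 1) {r r₀ : ℕ} {c : ℝ} (hr0 : 1 ≤ r₀) (hr : r₀ ≤ r)
    (hrm : r ≤ m) (hc : c ^ 2 * r₀ = r) (hw : ∑ i, w i ≤ r₀) :
    ∑ i, d i * (if (i : ℕ) < r then 1 else c) ^ 2 * w i
      ≤ ∑ i, d i * (if (i : ℕ) < r then 1 else 0) := by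
  set s := d ⟨r - 1, by omega⟩ with hs
  have hs0 : 0 ≤ s := hd0 _
  have hc1 : 1 ≤ c ^ 2 := by
    have h1 : (r₀ : ℝ) ≤ r := by exact_mod_cast hr
    have h2 : (1 : ℝ) ≤ r₀ := by exact_mod_cast hr0
    nlinarith
  have key : ∀ i, d i * (if (i : ℕ) < r then 1 else c) ^ 2 * w i
      ≤ d i * (if (i : ℕ) < r then 1 else 0) - s * (if (i : ℕ) < r then 1 else 0)
        + s * c ^ 2 * w i := by
    intro i
    split_ifs with hi
    · have h1 : s ≤ d i := hd (Fin.mk_le_mk.2 (by omega) : i ≤ ⟨r - 1, _⟩)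
      have h2 : s * w i ≤ s * w i * c ^ 2 :=
        le_mul_of_one_le_right (mul_nonneg hs0 (hw0 i)) hc1
      nlinarith [hw1 i]
    · have h1 : d i ≤ s := hd (Fin.mk_le_mk.2 (by omega) : (⟨r - 1, _⟩ : Fin m) ≤ i)
      have h2 := mul_le_mul_of_nonneg_right h1 (mul_nonneg (sq_nonneg c) (hw0 i))
      linarith
  refine (Finset.sum_le_sum fun i _ => key i).trans ?_
  rw [Finset.sum_add_distrib, Finset.sum_sub_distrib, ← Finset.mul_sum, ← Finset.mul_sum,
    sum_ite_val_lt hrm]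
  have := mul_le_mul_of_nonneg_left hw (mul_nonneg hs0 (sq_nonneg c))
  have h3 : s * c ^ 2 * r₀ = s * r := by rw [mul_assoc, hc]
  linarith

theorem frobSq_mul_of_gram_diagonal {H : Matrix (Fin n) (Fin m) ℝ} {d : Fin m → ℝ}
    (hH : Hᵀ * H = Matrix.diagonal d) (b : Matrix (Fin m) (Fin k) ℝ) :
    frobSq (H * b) = ∑ i, d i * ∑ l, b i l ^ 2 := by
  rw [← frobInner_self, frobInner_mul_left, ← Matrix.mul_assoc, hH]
  simp only [frobInner, Matrix.diagonal_mul, Finset.mul_sum]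
  exact Finset.sum_congr rfl fun i _ => Finset.sum_congr rfl fun l _ => by ring

/-- Comparison of the truncation of a matrix with orthogonal columns with a matrix of lower
rank. -/
theorem two_mul_frobInner_residual_le {H W : Matrix (Fin n) (Fin m) ℝ} {d : Fin m → ℝ}
    (hd : Antitone d) (hH : Hᵀ * H = Matrix.diagonal d) {r r₀ : ℕ} {c : ℝ} (hr0 : 1 ≤ r₀)
    (hr : r₀ ≤ r) (hrm : r ≤ m) (hc : c ^ 2 * r₀ = r) (hW : W.rank ≤ r₀) :
    2 * c * frobInner
        (H - H * Matrix.diagonal fun i : Fin m => if (i : ℕ) < r then (1 : ℝ) else 0) W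
      ≤ frobSq (W - H * Matrix.diagonal fun i : Fin m => if (i : ℕ) < r then (1 : ℝ) else 0) := by
  set e : Matrix (Fin m) (Fin m) ℝ :=
    Matrix.diagonal fun i : Fin m => if (i : ℕ) < r then (1 : ℝ) else 0 with he
  -- Expanding the square turns the claim into `2⟨H f, W⟩ ≤ ‖W‖² + ‖H e‖²` with `f = e + c (1 - e)`.
  -- Restricting to the row space of `W` before applying Young's inequality replaces `‖H f‖²` by a
  -- weighted sum of the `d i` whose total weight is the rank of `W`.
  set f : Matrix (Fin m) (Fin m) ℝ :=
    Matrix.diagonal fun i : Fin m => if (i : ℕ) < r then (1 : ℝ) else c with hf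
  have hfe : H * f = H * e + c • (H - H * e) := by
    have : f = e + c • (1 - e) := by
      rw [hf, he, ← Matrix.diagonal_one, Matrix.diagonal_sub, ← Matrix.diagonal_smul,
        Matrix.diagonal_add]
      congr 1
      funext i
      by_cases hi : (i : ℕ) < r <;> simp [hi]
    rw [this, Matrix.mul_add, Matrix.mul_smul, Matrix.mul_sub, Matrix.mul_one]
  obtain ⟨b, hb, hWb⟩ := exists_orthonormal_basis_rows W rfl
  have hd0 : ∀ i, 0 ≤ d i := by
    intro i
    have h := congrFun (congrFun hH i) i
    rw [Matrix.diagonal_apply_eq, Matrix.mul_apply] at h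
    rw [← h]
    exact Finset.sum_nonneg fun _ _ => mul_self_nonneg _
  have h1 : frobInner (H * f) W = frobInner (H * f * b) (W * b) := by
    rw [frobInner_mul_right (H * f), hWb]
  have h2 : 2 * frobInner (H * f * b) (W * b) ≤ frobSq (H * f * b) + frobSq (W * b) := by
    simpa using two_mul_frobInner_le one_pos (H * f * b) (W * b)
  have h3 : frobSq (W * b) ≤ frobSq W := frobSq_mul_orthonormal_le hb W
  have h4 : frobSq (H * f * b) ≤ frobSq (H * e) := by
    rw [Matrix.mul_assoc, frobSq_mul_of_gram_diagonal hH, frobSq_mul_of_gram_diagonal hH]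
    have := sum_weighted_le_sum_leading (w := fun i => ∑ l, b i l ^ 2) hd hd0
      (fun i => Finset.sum_nonneg fun _ _ => sq_nonneg _)
      (sum_sq_row_orthonormal_le_one hb) hr0 hr hrm hc
      (by
        have := frobSq_orthonormal hb
        rw [frobSq] at this
        rw [this]
        exact_mod_cast hW)
    refine le_trans (le_of_eq ?_) (this.trans (le_of_eq ?_))
    · refine Finset.sum_congr rfl fun i _ => ?_
      rw [mul_assoc, Finset.mul_sum (s := Finset.univ) (a := _ ^ 2)]
      congr 1
      refine Finset.sum_congr rfl fun l _ => ?_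
      rw [hf, Matrix.diagonal_mul, mul_pow]
    · refine Finset.sum_congr rfl fun i _ => ?_
      congr 1
      rw [Finset.sum_eq_single i]
      · simp [he]
      · intro l _ hl
        simp [he, Matrix.diagonal_apply_ne _ hl.symm]
      · simp
  rw [frobSq_sub, frobInner_comm W]
  rw [hfe, frobInner_add_left, frobInner_smul_left, ← hfe] at h1
  linarith

theorem submatrix_castLE_mul_transpose {r : ℕ} (h : r ≤ m) (U : Matrix (Fin m) (Fin m) ℝ) :
    U.submatrix id (Fin.castLE h) * (U.submatrix id (Fin.castLE h))ᵀ
      = U * Matrix.diagonal (fun i : Fin m => if (i : ℕ) < r then (1 : ℝ) else 0) * Uᵀ := by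
  ext i j
  rw [Matrix.mul_apply, Matrix.mul_apply]
  simp only [Matrix.submatrix_apply, Matrix.transpose_apply, id, Matrix.mul_diagonal]
  obtain ⟨t, rfl⟩ := Nat.exists_eq_add_of_le h
  rw [Fin.sum_univ_add]
  simp [Fin.castLE, Fin.castAdd]

theorem eq_zero_of_frobSq_eq_zero {A : Matrix (Fin n) (Fin m) ℝ} (h : frobSq A = 0) : A = 0 := by
  ext i j
  have h1 := (Finset.sum_eq_zero_iff_of_nonneg
    fun _ _ => Finset.sum_nonneg fun _ _ => sq_nonneg _).1 h i (Finset.mem_univ i)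
  have h2 := (Finset.sum_eq_zero_iff_of_nonneg fun _ _ => sq_nonneg _).1 h1 j (Finset.mem_univ j)
  simpa using h2

/-- The difference of the two sides lies in the column space of `X` and is annihilated by `Xᵀ`,
hence is orthogonal to itself. -/
theorem mul_gramInverse_mul_self {X : Matrix (Fin n) (Fin p) ℝ} {G : Matrix (Fin p) (Fin p) ℝ}
    (hG : Xᵀ * X * G * (Xᵀ * X) = Xᵀ * X) : X * G * Xᵀ * X = X := by
  have h1 : Xᵀ * (X * G * Xᵀ * X - X) = 0 := by
    rw [Matrix.mul_sub, sub_eq_zero]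
    simpa only [Matrix.mul_assoc] using hG
  have h2 : X * G * Xᵀ * X - X = X * (G * Xᵀ * X - 1) := by
    simp only [Matrix.mul_sub, Matrix.mul_one, Matrix.mul_assoc]
  rw [← sub_eq_zero]
  apply eq_zero_of_frobSq_eq_zero
  rw [← frobInner_self]
  nth_rewrite 1 [h2]
  rw [frobInner_mul_left, h1]
  simp [frobInner]

/-- The reduced-rank regression estimator compared with a competitor of lower rank. -/
theorem IsReducedRankRegression.two_mul_frobInner_le {X : Matrix (Fin n) (Fin p) ℝ}
    {Z : Matrix (Fin n) (Fin m) ℝ} {r r₀ : ℕ} {B : Matrix (Fin p) (Fin m) ℝ}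
    (hB : IsReducedRankRegression X Z r B) {B₀ : Matrix (Fin p) (Fin m) ℝ} {c : ℝ}
    (hr0 : 1 ≤ r₀) (hr : r₀ ≤ r) (hc : c ^ 2 * r₀ = r) (hB₀ : B₀.rank ≤ r₀) :
    2 * c * frobInner (Z - X * B) (X * B₀ - X * B) ≤ frobSq (X * B₀ - X * B) := by
  obtain ⟨G, V, hG, ⟨hrm, U, d, hU, hd, hS, rfl⟩, hBdef⟩ := hB
  set Q := X * G * Xᵀ with hQ
  set e : Matrix (Fin m) (Fin m) ℝ :=
    Matrix.diagonal fun i : Fin m => if (i : ℕ) < r then (1 : ℝ) else 0 with he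
  have hU' : U * Uᵀ = 1 := mul_eq_one_comm.1 hU
  have hQX : Q * X = X := mul_gramInverse_mul_self hG.mul_mul_self
  have hQtX : Qᵀ * X = X := by
    have h : Xᵀ * X * Gᵀ * (Xᵀ * X) = Xᵀ * X := by
      have := congrArg Matrix.transpose hG.mul_mul_self
      simpa only [Matrix.transpose_mul, Matrix.transpose_transpose, Matrix.mul_assoc] using this
    have h2 := mul_gramInverse_mul_self h
    rwa [hQ, Matrix.transpose_mul, Matrix.transpose_mul, Matrix.transpose_transpose,
      ← Matrix.mul_assoc X]
  have hQQ : Qᵀ * Q = Q := by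
    nth_rewrite 2 [hQ]
    rw [← Matrix.mul_assoc, ← Matrix.mul_assoc, hQtX]
  have hQt : Qᵀ = Q := by
    rw [← hQQ, Matrix.transpose_mul, Matrix.transpose_transpose]
  -- `Q` is the orthogonal projection onto the column space of `X`. Rotating by the eigenvectors `U`
  -- makes the columns of `Q Z` orthogonal with squared lengths `d`, and the estimator becomes
  -- truncation to the first `r` columns.
  set H := Q * Z * U with hH
  have hHH : Hᵀ * H = Matrix.diagonal d := by
    have : Hᵀ * H = Uᵀ * (Zᵀ * (Qᵀ * Q) * Z * U) := by
      simp only [hH, Matrix.transpose_mul, Matrix.mul_assoc]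
    rw [this, hQQ, hS, ← Matrix.mul_assoc, hU, Matrix.one_mul]
  have hXB : X * B = H * e * Uᵀ := by
    rw [hBdef, submatrix_castLE_mul_transpose]
    simp only [hH, hQ, he, Matrix.mul_assoc]
  have hXBU : X * B * U = H * e := by
    rw [hXB, Matrix.mul_assoc, hU, Matrix.mul_one]
  have hW : (X * B₀ * U).rank ≤ r₀ :=
    (Matrix.rank_mul_le_left _ _).trans ((Matrix.rank_mul_le_right _ _).trans hB₀)
  have main := two_mul_frobInner_residual_le hd hHH hr0 hr hrm hc hW
  rw [← he] at main
  have horth : frobInner (H - H * e) (H * e) = 0 := by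
    have h1 : (H - H * e)ᵀ * (H * e) = 0 := by
      rw [Matrix.transpose_sub, Matrix.transpose_mul H e, Matrix.sub_mul, Matrix.mul_assoc eᵀ,
        ← Matrix.mul_assoc, hHH, he, Matrix.diagonal_transpose, Matrix.diagonal_mul_diagonal,
        Matrix.diagonal_mul_diagonal, Matrix.diagonal_sub, ← Matrix.diagonal_zero]
      congr 1
      funext i
      by_cases hi : (i : ℕ) < r <;> simp [hi]
    rw [frobInner_eq_trace, h1, Matrix.trace_zero]
  have h1 : frobSq (X * B₀ - X * B) = frobSq (X * B₀ * U - H * e) := by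
    rw [← hXBU, ← Matrix.sub_mul, frobSq_mul_orthogonal hU']
  have h2 : frobInner (Z - X * B) (X * B₀ - X * B)
      = frobInner (H - H * e) (X * B₀ * U) := by
    have h3 : frobInner (Z - X * B) (X * B₀ - X * B)
        = frobInner (Q * Z - X * B) (X * B₀ - X * B) := by
      rw [frobInner_sub_left, frobInner_sub_left, frobInner_mul_left Q, hQt, Matrix.mul_sub,
        ← Matrix.mul_assoc, ← Matrix.mul_assoc, hQX]
    rw [h3, ← frobInner_mul_orthogonal hU', Matrix.sub_mul, Matrix.sub_mul, ← hH, hXBU,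
      frobInner_sub_right, horth, sub_zero]
  rw [h1, h2]
  exact main

end ReducedRank

end RobustRRR
namespace RobustRRR

/-! ### Thresholding -/

section Threshold

variable {Θ : ℝ → ℝ → ℝ} {lam : ℝ}

theorem IsThreshold.bddAbove (hΘ : IsThreshold Θ) (hlam : 0 ≤ lam) (u : ℝ) :
    BddAbove {t : ℝ | Θ t lam ≤ u} := by
  obtain ⟨T, hT⟩ := ((hΘ.tendsto lam hlam).eventually_gt_atTop u).exists
  refine ⟨T, fun t ht => ?_⟩
  by_contra! h
  exact absurd (hΘ.mono lam hlam T t h.le) (not_le.2 (lt_of_le_of_lt ht hT))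

theorem IsThreshold.le_thetaInv (hΘ : IsThreshold Θ) (hlam : 0 ≤ lam) {t u : ℝ}
    (h : Θ t lam ≤ u) : t ≤ thetaInv Θ lam u :=
  le_csSup (hΘ.bddAbove hlam u) h

theorem IsThreshold.self_le_thetaInv (hΘ : IsThreshold Θ) (hlam : 0 ≤ lam) {u : ℝ} (hu : 0 ≤ u) :
    u ≤ thetaInv Θ lam u :=
  hΘ.le_thetaInv hlam (hΘ.bounds lam hlam u hu).2

theorem IsThreshold.apply_zero (hΘ : IsThreshold Θ) (hlam : 0 ≤ lam) : Θ 0 lam = 0 :=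
  le_antisymm (hΘ.bounds lam hlam 0 le_rfl).2 (hΘ.bounds lam hlam 0 le_rfl).1

theorem IsThreshold.thetaInv_le (hΘ : IsThreshold Θ) (hlam : 0 ≤ lam) {y u : ℝ} (hu : 0 ≤ u)
    (h : u < Θ y lam) : thetaInv Θ lam u ≤ y := by
  refine csSup_le ⟨0, ?_⟩ fun t ht => ?_
  · simpa [hΘ.apply_zero hlam] using hu
  · by_contra! h2
    exact absurd (hΘ.mono lam hlam y t h2.le) (not_le.2 (lt_of_le_of_lt ht h))

theorem IsThreshold.monotoneOn_thetaInv (hΘ : IsThreshold Θ) (hlam : 0 ≤ lam) :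
    MonotoneOn (thetaInv Θ lam) (Set.Ici 0) := by
  intro u hu v _ huv
  refine csSup_le_csSup (hΘ.bddAbove hlam v) ⟨0, ?_⟩ fun t ht => le_trans ht huv
  simpa [hΘ.apply_zero hlam] using hu

/-- The real-valued `essInf` is an almost everywhere lower bound only once some lower bound is
known; monotonicity of `Θ⁻¹` supplies 0. -/
theorem IsThreshold.ae_le_deriv (hΘ : IsThreshold Θ) (hlam : 0 ≤ lam) :
    ∀ᵐ u ∂(volume.restrict (Set.Ici (0 : ℝ))),
      1 - lossTheta Θ lam ≤ deriv (thetaInv Θ lam) u := by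
  have h0 : ∀ᵐ u ∂(volume.restrict (Set.Ici (0 : ℝ))), 0 ≤ deriv (thetaInv Θ lam) u := by
    rw [← Measure.restrict_congr_set (Ioi_ae_eq_Ici (a := (0 : ℝ)))]
    filter_upwards [ae_restrict_mem measurableSet_Ioi] with u hu
    rw [← derivWithin_of_mem_nhds (Ici_mem_nhds hu)]
    exact (hΘ.monotoneOn_thetaInv hlam).derivWithin_nonneg
  have := ae_essInf_le (μ := volume.restrict (Set.Ici (0 : ℝ)))
    (f := fun u => deriv (thetaInv Θ lam) u) ⟨0, h0⟩
  simpa [lossTheta] using this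

/-- A monotone function increases by at least the integral of its derivative; jumps and singular
parts only help. -/
theorem IsThreshold.thetaInv_sub_le (hΘ : IsThreshold Θ) (hlam : 0 ≤ lam) {u v : ℝ} (hu : 0 ≤ u)
    (huv : u ≤ v) :
    (1 - lossTheta Θ lam) * (v - u) ≤ thetaInv Θ lam v - thetaInv Θ lam u := by
  have hsub : Set.uIcc u v ⊆ Set.Ici 0 := by
    rw [Set.uIcc_of_le huv]
    exact fun x hx => hu.trans hx.1
  have hmono := (hΘ.monotoneOn_thetaInv hlam).mono hsub
  have h1 := hmono.intervalIntegral_deriv_mem_uIcc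
  rw [Set.uIcc_of_le (sub_nonneg.2 (hmono Set.left_mem_uIcc Set.right_mem_uIcc huv))] at h1
  refine le_trans ?_ h1.2
  have h2 : ∫ _ in u..v, (1 - lossTheta Θ lam) = (1 - lossTheta Θ lam) * (v - u) := by
    rw [intervalIntegral.integral_const, smul_eq_mul, mul_comm]
  rw [← h2]
  refine intervalIntegral.integral_mono_ae_restrict huv intervalIntegrable_const
    hmono.intervalIntegrable_deriv ?_
  refine ae_mono (Measure.restrict_mono ?_ le_rfl) (hΘ.ae_le_deriv hlam)
  rwa [Set.uIcc_of_le huv] at hsub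

theorem IsThreshold.add_le_thetaInv (hΘ : IsThreshold Θ) (hlam : 0 ≤ lam) {y u : ℝ} (hy : 0 ≤ y)
    (h : Θ y lam ≤ u) :
    y + (1 - lossTheta Θ lam) * (u - Θ y lam) ≤ thetaInv Θ lam u := by
  have h1 := hΘ.thetaInv_sub_le hlam (hΘ.bounds lam hlam y hy).1 h
  have h2 := hΘ.le_thetaInv hlam (le_refl (Θ y lam))
  linarith

/-- At the endpoint `Θ(y)` itself `Θ⁻¹` may jump above `y`, so the growth bound is applied up to `v
< Θ(y)`, where `Θ⁻¹(v) ≤ y`, and then `v` tends to `Θ(y)` from the left. -/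
theorem IsThreshold.thetaInv_le_sub (hΘ : IsThreshold Θ) (hlam : 0 ≤ lam) {y u : ℝ} (hu : 0 ≤ u)
    (h : u < Θ y lam) :
    thetaInv Θ lam u ≤ y + (1 - lossTheta Θ lam) * (u - Θ y lam) := by
  have hlim : Filter.Tendsto (fun v => y + (1 - lossTheta Θ lam) * (u - v))
      (nhdsWithin (Θ y lam) (Set.Iio (Θ y lam)))
      (nhds (y + (1 - lossTheta Θ lam) * (u - Θ y lam))) := by
    refine Filter.Tendsto.mono_left (Continuous.tendsto ?_ _) nhdsWithin_le_nhds
    fun_prop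
  refine ge_of_tendsto hlim ?_
  filter_upwards [Ioo_mem_nhdsLT h] with v hv
  have h1 := hΘ.thetaInv_sub_le hlam hu hv.1.le
  have h2 := hΘ.thetaInv_le hlam (hu.trans hv.1.le) hv.2
  linarith

theorem IsThreshold.mul_apply_le (hΘ : IsThreshold Θ) (hlam : 0 ≤ lam) {y : ℝ} (hy : 0 ≤ y) :
    (1 - lossTheta Θ lam) * Θ y lam ≤ y := by
  rcases (hΘ.bounds lam hlam y hy).1.eq_or_lt with h | h
  · rw [← h, mul_zero]; exact hy
  · have h1 := hΘ.thetaInv_le_sub hlam le_rfl h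
    have h2 := hΘ.self_le_thetaInv hlam (le_refl (0 : ℝ))
    linarith

theorem IsThreshold.intervalIntegrable_thetaInv (hΘ : IsThreshold Θ) (hlam : 0 ≤ lam) {a b : ℝ}
    (ha : 0 ≤ a) (hb : 0 ≤ b) : IntervalIntegrable (thetaInv Θ lam) volume a b := by
  refine MonotoneOn.intervalIntegrable ((hΘ.monotoneOn_thetaInv hlam).mono fun x hx => ?_)
  exact (le_min ha hb).trans hx.1

theorem IsThreshold.penTheta_sub (hΘ : IsThreshold Θ) (hlam : 0 ≤ lam) {t s : ℝ} (ht : 0 ≤ t)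
    (hs : 0 ≤ s) :
    penTheta Θ t lam - penTheta Θ s lam
      = (∫ u in s..t, thetaInv Θ lam u) - (t ^ 2 / 2 - s ^ 2 / 2) := by
  have hint : ∀ a b : ℝ, 0 ≤ a → 0 ≤ b →
      IntervalIntegrable (fun u => thetaInv Θ lam u - u) volume a b := fun a b ha hb =>
    (hΘ.intervalIntegrable_thetaInv hlam ha hb).sub intervalIntegral.intervalIntegrable_id
  rw [penTheta, penTheta, abs_of_nonneg ht, abs_of_nonneg hs,
    intervalIntegral.integral_interval_sub_left (hint 0 t le_rfl ht) (hint 0 s le_rfl hs),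
    intervalIntegral.integral_sub (hΘ.intervalIntegrable_thetaInv hlam hs ht)
      intervalIntegral.intervalIntegrable_id, integral_id]
  ring

/-- Scalar optimality of `Θ(y)` for the objective with penalty `P_Θ`. -/
theorem IsThreshold.scalar_optimality (hΘ : IsThreshold Θ) (hlam : 0 ≤ lam) {y t : ℝ}
    (hy : 0 ≤ y) (ht : 0 ≤ t) :
    y * (t - Θ y lam) + (1 - lossTheta Θ lam) / 2 * (t - Θ y lam) ^ 2
      ≤ penTheta Θ t lam + t ^ 2 / 2 - penTheta Θ (Θ y lam) lam - Θ y lam ^ 2 / 2 := by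
  set s := Θ y lam with hs
  have hs0 : 0 ≤ s := (hΘ.bounds lam hlam y hy).1
  have h1 := hΘ.penTheta_sub hlam ht hs0
  -- `Θ⁻¹` integrates to `P_Θ(u) + u²/2`. It lies above the line through `(s, y)` of slope `1 - L_Θ`
  -- to the right of `s` and below it to the left, so integrating the line gives the bound in either
  -- direction.
  suffices h : y * (t - s) + (1 - lossTheta Θ lam) / 2 * (t - s) ^ 2
      ≤ ∫ u in s..t, thetaInv Θ lam u by linarith
  have hc : ∀ a b : ℝ, IntervalIntegrable (fun u => y + (1 - lossTheta Θ lam) * (u - s))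
      volume a b := fun a b => Continuous.intervalIntegrable (by fun_prop) a b
  have h2 : ∀ a b : ℝ, ∫ u in a..b, (y + (1 - lossTheta Θ lam) * (u - s))
      = y * (b - a) + (1 - lossTheta Θ lam) * ((b - s) ^ 2 / 2 - (a - s) ^ 2 / 2) := by
    intro a b
    rw [intervalIntegral.integral_add (by simp)
      (Continuous.intervalIntegrable (by fun_prop) a b), intervalIntegral.integral_const,
      intervalIntegral.integral_const_mul, intervalIntegral.integral_comp_sub_right (fun u => u),
      integral_id, smul_eq_mul]
    ring
  rcases le_total s t with hst | hst
  · have h3 := intervalIntegral.integral_mono_on hst (hc s t)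
      (hΘ.intervalIntegrable_thetaInv hlam hs0 ht)
      fun u hu => hΘ.add_le_thetaInv hlam hy hu.1
    rw [h2] at h3
    linarith
  · have h3 := intervalIntegral.integral_mono_on_of_le_Ioo hst
      (hΘ.intervalIntegrable_thetaInv hlam ht hs0) (hc t s)
      fun u hu => hΘ.thetaInv_le_sub hlam (ht.trans hu.1.le) hu.2
    rw [h2] at h3
    rw [intervalIntegral.integral_symm]
    linarith

variable {n m : ℕ}

theorem rowNorm_nonneg (A : Matrix (Fin n) (Fin m) ℝ) (i : Fin n) : 0 ≤ rowNorm A i :=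
  Real.sqrt_nonneg _

theorem rowNorm_sq (A : Matrix (Fin n) (Fin m) ℝ) (i : Fin n) :
    rowNorm A i ^ 2 = ∑ j, A i j ^ 2 :=
  Real.sq_sqrt (Finset.sum_nonneg fun _ _ => sq_nonneg _)

theorem row_inner_le (A B : Matrix (Fin n) (Fin m) ℝ) (i : Fin n) :
    ∑ j, A i j * B i j ≤ rowNorm A i * rowNorm B i :=
  Real.sum_mul_le_sqrt_mul_sqrt _ _ _

theorem rowNorm_multiThreshold (hΘ : IsThreshold Θ) (hlam : 0 ≤ lam)
    (Y : Matrix (Fin n) (Fin m) ℝ) (i : Fin n) :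
    rowNorm (multiThreshold Θ lam Y) i = Θ (rowNorm Y i) lam := by
  have h0 := (hΘ.bounds lam hlam _ (rowNorm_nonneg Y i)).1
  have h : rowNorm (multiThreshold Θ lam Y) i ^ 2 = Θ (rowNorm Y i) lam ^ 2 := by
    rw [rowNorm_sq]
    simp only [multiThreshold, Matrix.of_apply, mul_pow]
    rw [← Finset.sum_mul, ← rowNorm_sq]
    rcases eq_or_ne (rowNorm Y i) 0 with h | h
    · rw [h, hΘ.apply_zero hlam]; simp
    · field_simp
  exact (sq_eq_sq₀ (rowNorm_nonneg _ _) h0).1 h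

theorem sum_sub_sq (a b : Fin m → ℝ) :
    ∑ j, (a j - b j) ^ 2 = ∑ j, a j ^ 2 - 2 * ∑ j, a j * b j + ∑ j, b j ^ 2 := by
  rw [Finset.mul_sum, ← Finset.sum_sub_distrib, ← Finset.sum_add_distrib]
  exact Finset.sum_congr rfl fun _ _ => by ring

/-- For a row of `C` parallel to that of `Y`, with the same direction, this is twice the scalar
inequality. In general the two differ by the Cauchy–Schwarz gap times `2(1 - (1 - L)Θ(y)/y)`, which
is nonnegative by `IsThreshold.mul_apply_le`. -/
theorem multiThreshold_row_optimality (hΘ : IsThreshold Θ) (hlam : 0 ≤ lam)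
    (Y C : Matrix (Fin n) (Fin m) ℝ) (i : Fin n) :
    (1 - lossTheta Θ lam) * ∑ j, (multiThreshold Θ lam Y i j - C i j) ^ 2
        + ∑ j, (Y i j - multiThreshold Θ lam Y i j) ^ 2
        + 2 * penTheta Θ (rowNorm (multiThreshold Θ lam Y) i) lam
      ≤ ∑ j, (Y i j - C i j) ^ 2 + 2 * penTheta Θ (rowNorm C i) lam := by
  have hopt := hΘ.scalar_optimality hlam (rowNorm_nonneg Y i) (rowNorm_nonneg C i)
  have hCS := row_inner_le Y C i
  have hle := hΘ.mul_apply_le hlam (rowNorm_nonneg Y i)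
  have h1 : ∑ j, multiThreshold Θ lam Y i j * C i j
      = Θ (rowNorm Y i) lam / rowNorm Y i * ∑ j, Y i j * C i j := by
    rw [Finset.mul_sum]
    refine Finset.sum_congr rfl fun j _ => ?_
    simp only [multiThreshold, Matrix.of_apply]
    ring
  have h2 : ∑ j, Y i j * multiThreshold Θ lam Y i j
      = Θ (rowNorm Y i) lam / rowNorm Y i * rowNorm Y i ^ 2 := by
    rw [rowNorm_sq, Finset.mul_sum]
    refine Finset.sum_congr rfl fun j _ => ?_
    simp only [multiThreshold, Matrix.of_apply]
    ring
  rw [sum_sub_sq, sum_sub_sq, sum_sub_sq, h1, h2, ← rowNorm_sq, ← rowNorm_sq, ← rowNorm_sq,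
    rowNorm_multiThreshold hΘ hlam]
  generalize (∑ j, Y i j * C i j) = z at hCS ⊢
  have hz := hΘ.apply_zero hlam
  generalize rowNorm C i = t at hCS hopt ⊢
  have hY := rowNorm_nonneg Y i
  generalize hu : Θ (rowNorm Y i) lam = u at hopt hle ⊢
  generalize rowNorm Y i = y at hopt hle hCS hY hu ⊢
  generalize lossTheta Θ lam = L at hopt hle ⊢
  -- For a zero row the quotient `u / y` is 0 by the convention for division, matching the
  -- convention for `Θ⃗` at 0.
  rcases hY.eq_or_lt with h | h
  · subst h
    rw [hz] at hu
    subst hu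
    simp only [div_zero, zero_mul, mul_zero, sub_zero] at *
    linarith
  · have h3 : u / y * y ^ 2 = u * y := by field_simp
    have h4 : 0 ≤ (1 - (1 - L) * u / y) * (y * t - z) := by
      refine mul_nonneg ?_ (by linarith)
      rw [sub_nonneg, div_le_one h]
      exact hle
    have h5 : (1 - (1 - L) * u / y) * (y * t - z)
        = y * t - z - (1 - L) * u * t + (1 - L) * (u / y * z) := by
      field_simp
      ring
    rw [h3]
    nlinarith

/-- Optimality of the multivariate thresholding for the penalty `P_{2,Θ}`. -/
theorem multiThreshold_optimality (hΘ : IsThreshold Θ) (hlam : 0 ≤ lam)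
    (Y C : Matrix (Fin n) (Fin m) ℝ) :
    (1 - lossTheta Θ lam) * frobSq (multiThreshold Θ lam Y - C)
        + frobSq (Y - multiThreshold Θ lam Y) + 2 * pen2Theta Θ (multiThreshold Θ lam Y) lam
      ≤ frobSq (Y - C) + 2 * pen2Theta Θ C lam := by
  have h := Finset.sum_le_sum fun i (_ : i ∈ Finset.univ) =>
    multiThreshold_row_optimality hΘ hlam Y C i
  simp only [Finset.sum_add_distrib, ← Finset.mul_sum] at h
  exact h

end Threshold

end RobustRRR
namespace RobustRRR

/-! ### Deterministic oracle inequality -/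

section Deterministic

variable {n m p : ℕ}

/-- With `S` and `T` as generalized below, the rank comparison contributes `2‖S‖² + 2⟨S, T⟩` and
thresholding `(2 - L)‖T‖² + 2⟨S, T⟩`. Their sum is `2‖S + T‖² - L‖T‖²`; the error terms `(1 +
α)^(-1/2)‖S‖²`, `L‖T‖²` and the penalty of `C` are precisely those in the regularity inequality. -/
theorem fixedPoint_basic_inequality {Θ : ℝ → ℝ → ℝ} {lam α δ ϑ ζ : ℝ} (hΘ : IsThreshold Θ)
    (hlam : 0 ≤ lam) (hα : 0 ≤ α) {X : Matrix (Fin n) (Fin p) ℝ}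
    {Bstar B : Matrix (Fin p) (Fin m) ℝ} {Cstar C E : Matrix (Fin n) (Fin m) ℝ} {r : ℕ}
    (hrank : 1 ≤ Bstar.rank) (hr : (r : ℝ) = (1 + α) * Bstar.rank)
    (hfix : IsFixedPoint Θ lam X (X * Bstar + Cstar + E) r B C)
    (hreg : RegularityIneq Θ lam α δ ϑ ζ X Bstar Cstar B C) :
    δ * predError X (B - Bstar) (C - Cstar) + ϑ * pen2H (C - Cstar) lam
      ≤ 2 * frobInner E (X * (B - Bstar) + (C - Cstar)) + 2 * pen2Theta Θ Cstar lam
        + ζ * pen20 Cstar lam := by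
  have hpos : 0 < 1 + α := by linarith
  set c : ℝ := Real.sqrt (1 + α) with hc
  have hc0 : 0 < c := Real.sqrt_pos.2 hpos
  have hc2 : c ^ 2 = 1 + α := Real.sq_sqrt hpos.le
  have hle : Bstar.rank ≤ r := by
    have : (Bstar.rank : ℝ) ≤ r := by
      rw [hr]
      exact le_mul_of_one_le_left (Nat.cast_nonneg _) (by linarith)
    exact_mod_cast this
  have h1 := hfix.1.two_mul_frobInner_le hrank hle (c := c) (by rw [hc2, hr]) le_rfl
  have h2 := multiThreshold_optimality hΘ hlam (X * Bstar + Cstar + E - X * B) Cstar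
  rw [← hfix.2] at h2
  have hrho : (1 + α) ^ (-(1 / 2) : ℝ) = c⁻¹ := by
    rw [Real.rpow_neg hpos.le, hc, Real.sqrt_eq_rpow]
  rw [RegularityIneq, hrho, predError] at hreg
  rw [predError]
  have e0 : X * (B - Bstar) = X * B - X * Bstar := Matrix.mul_sub _ _ _
  rw [e0] at hreg ⊢
  have e1 : X * Bstar + Cstar + E - C - X * B = E - (X * B - X * Bstar) - (C - Cstar) := by abel
  have e2 : X * Bstar - X * B = -(X * B - X * Bstar) := by abel
  have e3 : X * Bstar + Cstar + E - X * B - C = E - (X * B - X * Bstar) - (C - Cstar) := by abel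
  have e4 : X * Bstar + Cstar + E - X * B - Cstar = E - (X * B - X * Bstar) := by abel
  rw [e1, e2, frobSq_neg] at h1
  rw [e3, e4] at h2
  generalize X * B - X * Bstar = S at *
  generalize C - Cstar = T at *
  have h3 : frobInner (E - S - T) (-S)
      = -frobInner E S + frobSq S + frobInner S T := by
    rw [← zero_sub S, frobInner_sub_right, frobInner_sub_left (E - S) T S,
      frobInner_sub_left E S S, frobInner_self, frobInner_comm T S]
    simp [frobInner]
    ring
  rw [h3] at h1
  rw [frobSq_sub (E - S) T, frobInner_sub_left] at h2
  rw [frobSq_add] at hreg ⊢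
  rw [frobInner_add_right]
  have h4 : 2 * (-frobInner E S + frobSq S + frobInner S T) ≤ c⁻¹ * frobSq S := by
    rw [inv_mul_eq_div, le_div_iff₀ hc0]
    linarith
  linarith

theorem pen2Theta_le_of_associated {Θ P : ℝ → ℝ → ℝ} {K lam : ℝ}
    (hP : IsAssociatedPenalty Θ P lam) (hK : IsBoundedPenalty P K lam)
    (C : Matrix (Fin n) (Fin m) ℝ) :
    pen2Theta Θ C lam ≤ K * lam ^ 2 * numNonzeroRows C := by
  classical
  obtain ⟨q, hq0, -, hq⟩ := hP
  have hle : ∀ i, penTheta Θ (rowNorm C i) lam ≤ if C i ≠ 0 then K * lam ^ 2 else 0 := by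
    intro i
    split_ifs with h
    · have h1 := hq (rowNorm C i)
      rw [hK.1] at h1
      linarith [hq0 (rowNorm C i), (hK.2 (rowNorm C i)).2]
    · rw [not_not] at h
      simp [rowNorm, h, penTheta]
  have hsum : ∀ (s : Fin n → Prop) [DecidablePred s] (a : ℝ),
      ∑ i, (if s i then a else 0) = a * (Finset.univ.filter s).card := by
    intro s _ a
    rw [← Finset.sum_filter, Finset.sum_const, nsmul_eq_mul, mul_comm]
  refine (Finset.sum_le_sum fun i _ => hle i).trans (le_of_eq ?_)
  rw [numNonzeroRows]
  convert hsum (fun i => C i ≠ 0) (K * lam ^ 2)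

/-! ### Noise paired with low-rank and row-sparse matrices -/

/-- Only the action of `N` on an orthonormal basis of the row space of `M` matters: at most `s`
vectors, each contributing at most `b`. -/
theorem two_mul_frobInner_le_of_rank {k s : ℕ} {a b : ℝ} (ha : 0 < a) (hb : 0 ≤ b)
    {N M : Matrix (Fin k) (Fin m) ℝ} (hM : M.rank ≤ s)
    (hN : ∀ v : Fin m → ℝ, ∑ j, v j ^ 2 = 1 → ∑ i, (N *ᵥ v) i ^ 2 ≤ b) :
    2 * frobInner N M ≤ a⁻¹ * (s * b) + a * frobSq M := by
  obtain ⟨c, hc, hMc⟩ := exists_orthonormal_basis_rows M rfl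
  have h1 : frobInner N M = frobInner (N * c) (M * c) := by
    rw [frobInner_mul_right, hMc]
  have h2 : frobSq (N * c) ≤ s * b := by
    rw [← frobSq_transpose, frobSq]
    have h3 : ∀ l ∈ Finset.univ, ∑ i, (N * c)ᵀ l i ^ 2 ≤ b := by
      intro l _
      refine hN (fun j => c j l) ?_
      have := congrFun (congrFun hc l) l
      rw [Matrix.mul_apply, Matrix.one_apply_eq] at this
      rw [← this]
      exact Finset.sum_congr rfl fun j _ => sq _
    refine (Finset.sum_le_card_nsmul _ _ _ h3).trans ?_
    rw [Finset.card_univ, Fintype.card_fin, nsmul_eq_mul]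
    exact mul_le_mul_of_nonneg_right (by exact_mod_cast hM) hb
  rw [h1]
  refine (two_mul_frobInner_le ha _ _).trans (add_le_add ?_ ?_)
  · exact mul_le_mul_of_nonneg_left h2 (inv_nonneg.2 ha.le)
  · exact mul_le_mul_of_nonneg_left (frobSq_mul_orthonormal_le hc M) ha.le

/-- The diagonal matrix selecting the rows in `I`. -/
def rowSelect (I : Finset (Fin n)) : Matrix (Fin n) (Fin n) ℝ :=
  Matrix.diagonal fun i => if i ∈ I then 1 else 0

theorem rowSelect_mul_apply (I : Finset (Fin n)) (A : Matrix (Fin n) (Fin m) ℝ) (i : Fin n)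
    (j : Fin m) : (rowSelect I * A) i j = if i ∈ I then A i j else 0 := by
  rw [rowSelect, Matrix.diagonal_mul]
  split_ifs <;> simp

theorem rowSelect_rank_le (I : Finset (Fin n)) : (rowSelect I).rank ≤ I.card := by
  rw [rowSelect, Matrix.rank_diagonal]
  refine le_of_eq ?_
  simp

theorem frobInner_rowSelect_mul (I : Finset (Fin n)) (A B : Matrix (Fin n) (Fin m) ℝ) :
    frobInner A (rowSelect I * B) = frobInner (rowSelect I * A) (rowSelect I * B) := by
  refine Finset.sum_congr rfl fun i _ => Finset.sum_congr rfl fun j _ => ?_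
  rw [rowSelect_mul_apply, rowSelect_mul_apply]
  split_ifs <;> simp

theorem frobSq_rowSelect_add (I : Finset (Fin n)) (A : Matrix (Fin n) (Fin m) ℝ) :
    frobSq (rowSelect I * A) + frobSq (A - rowSelect I * A) = frobSq A := by
  rw [frobSq_sub, frobInner_rowSelect_mul, frobInner_self]
  ring

theorem frobSq_rowSelect (I : Finset (Fin n)) (A : Matrix (Fin n) (Fin m) ℝ) :
    frobSq (rowSelect I * A) = ∑ i ∈ I, rowNorm A i ^ 2 := by
  classical
  rw [← Finset.univ_inter I, ← Finset.sum_ite_mem]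
  refine Finset.sum_congr rfl fun i _ => ?_
  simp only [rowSelect_mul_apply, Finset.univ_inter]
  split_ifs
  · rw [rowNorm_sq]
  · simp

theorem frobSq_sub_rowSelect (I : Finset (Fin n)) (A : Matrix (Fin n) (Fin m) ℝ) :
    frobSq (A - rowSelect I * A) = ∑ i ∈ Iᶜ, rowNorm A i ^ 2 := by
  have h1 := frobSq_rowSelect_add I A
  have h2 := Finset.sum_add_sum_compl I fun i => rowNorm A i ^ 2
  rw [← frobSq_eq_sum_rowNorm, ← frobSq_rowSelect] at h2
  linarith

theorem frobInner_sub_rowSelect (I : Finset (Fin n)) (A B : Matrix (Fin n) (Fin m) ℝ) :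
    frobInner A (B - rowSelect I * B) = ∑ i ∈ Iᶜ, ∑ j, A i j * B i j := by
  classical
  rw [← Finset.univ_inter Iᶜ, ← Finset.sum_ite_mem]
  refine Finset.sum_congr rfl fun i _ => ?_
  simp only [Finset.mem_compl, Matrix.sub_apply,
    rowSelect_mul_apply]
  split_ifs <;> simp

theorem penH_of_lt {t lam : ℝ} (ht : 0 ≤ t) (h : t < lam) :
    penH t lam = -t ^ 2 / 2 + lam * t := by
  rw [penH, abs_of_nonneg ht, if_pos h]

theorem penH_of_le {t lam : ℝ} (ht : 0 ≤ t) (h : lam ≤ t) : penH t lam = lam ^ 2 / 2 := by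
  rw [penH, abs_of_nonneg ht, if_neg (not_lt.2 h)]

theorem sq_le_two_mul_penH {t lam : ℝ} (ht : 0 ≤ t) (h : t < lam) :
    t ^ 2 ≤ 2 * penH t lam := by
  rw [penH_of_lt ht h]
  nlinarith

/-- Below the threshold `P_H(t) ≥ λt/2`, so noise `e ≤ ϑλ/8` is absorbed by the penalty. Larger
noise satisfies `τλ² ≤ e²/2`, so at least half of `e²` is excess `ρ`, and `e t ≤ e λ ≤ (8/ϑ) e²`. -/
theorem two_mul_mul_le_penH {t lam e ϑ τ ρ : ℝ} (hϑ : 0 < ϑ) (ht : 0 ≤ t) (h : t < lam)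
    (he : 0 ≤ e) (hρ : 0 ≤ ρ) (heρ : e ^ 2 ≤ τ * lam ^ 2 + ρ) (hτ : τ ≤ ϑ ^ 2 / 128) :
    2 * (e * t) ≤ ϑ / 2 * penH t lam + 32 / ϑ * ρ := by
  have hlam : 0 < lam := ht.trans_lt h
  rw [penH_of_lt ht h]
  rcases le_total e (ϑ * lam / 8) with h1 | h1
  · have h2 : 0 ≤ 32 / ϑ * ρ := by positivity
    have h3 : e * t ≤ ϑ * lam / 8 * t := mul_le_mul_of_nonneg_right h1 ht
    have h4 : 0 ≤ ϑ * (t * (lam - t)) := by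
      have : 0 ≤ lam - t := by linarith
      positivity
    nlinarith
  · have h2 : e * t ≤ e * lam := mul_le_mul_of_nonneg_left h.le he
    have h3 : e * lam ≤ 8 / ϑ * e ^ 2 := by
      rw [div_mul_eq_mul_div, le_div_iff₀ hϑ]
      nlinarith
    have h4 : e ^ 2 ≤ 2 * ρ := by
      have h5 : τ * lam ^ 2 ≤ ϑ ^ 2 / 128 * lam ^ 2 :=
        mul_le_mul_of_nonneg_right hτ (sq_nonneg _)
      have h6 : (ϑ * lam / 8) ^ 2 ≤ e ^ 2 := by
        have : 0 ≤ ϑ * lam / 8 := by positivity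
        gcongr
      nlinarith
    have h7 : 8 / ϑ * e ^ 2 ≤ 8 / ϑ * (2 * ρ) := by gcongr
    have h8 : 0 ≤ ϑ / 2 * (-t ^ 2 / 2 + lam * t) := by
      have : 0 ≤ -t ^ 2 / 2 + lam * t := by nlinarith
      positivity
    have h9 : 2 * (8 / ϑ * (2 * ρ)) = 32 / ϑ * ρ := by ring
    linarith

theorem frobSq_sub_projection_le {k : ℕ} {b : Matrix (Fin n) (Fin k) ℝ} (hb : bᵀ * b = 1)
    (A : Matrix (Fin n) (Fin m) ℝ) : frobSq (A - b * (bᵀ * A)) ≤ frobSq A := by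
  have h1 : frobInner A (b * (bᵀ * A)) = frobSq (bᵀ * A) := by
    rw [frobInner_comm, frobInner_mul_left, frobInner_self]
  have h2 : frobSq (b * (bᵀ * A)) = frobSq (bᵀ * A) := by
    rw [← frobInner_self, frobInner_mul_left, ← Matrix.mul_assoc, hb, Matrix.one_mul,
      frobInner_self]
  rw [frobSq_sub, h1, h2]
  linarith [frobSq_nonneg (bᵀ * A)]

/-- Bound on the stochastic term for a low-rank part with the rows in `I` removed. -/
theorem two_mul_frobInner_sub_rowSelect_le {q k s : ℕ} {a β : ℝ} (ha : 0 < a) (hβ : 0 ≤ β)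
    {E W : Matrix (Fin n) (Fin m) ℝ} {bX : Matrix (Fin n) (Fin q) ℝ} (hbX : bXᵀ * bX = 1)
    (hW : bX * (bXᵀ * W) = W) (hWs : W.rank ≤ s) {I : Finset (Fin n)}
    {b : Matrix (Fin n) (Fin k) ℝ} (hb : bᵀ * b = 1)
    (hbI : b * (bᵀ * (rowSelect I - bX * (bXᵀ * rowSelect I)))
      = rowSelect I - bX * (bXᵀ * rowSelect I))
    (hE : ∀ v : Fin m → ℝ, ∑ j, v j ^ 2 = 1 → ∑ i, ((bXᵀ * E) *ᵥ v) i ^ 2 ≤ β) :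
    2 * frobInner E (W - rowSelect I * W)
      ≤ 2 * a⁻¹ * (s * β + frobSq (bᵀ * E)) + a * frobSq (W - rowSelect I * W) := by
  set V := W - rowSelect I * W with hV
  have hrank : (bXᵀ * V).rank ≤ s := by
    have : bXᵀ * V = bXᵀ * (1 - rowSelect I) * W := by
      rw [hV, Matrix.mul_sub, Matrix.mul_sub, Matrix.sub_mul, Matrix.mul_one, Matrix.mul_assoc]
    rw [this]
    exact (Matrix.rank_mul_le_right _ _).trans hWs
  have h1 := two_mul_frobInner_le_of_rank (half_pos ha) hβ hrank hE
  -- Since `W` lies in the column space of `X`, the part of `W - R W` outside that space comes from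
  -- `R W` alone. It therefore lies in the range of `(1 - P_X) R`, which depends on `I` but not on
  -- `W`.
  have h2 : V - bX * (bXᵀ * V) = b * (bᵀ * (V - bX * (bXᵀ * V))) := by
    have h3 : V - bX * (bXᵀ * V) = -((rowSelect I - bX * (bXᵀ * rowSelect I)) * W) := by
      rw [hV, Matrix.mul_sub, Matrix.mul_sub, hW, Matrix.sub_mul]
      simp only [Matrix.mul_assoc]
      abel
    rw [h3, Matrix.mul_neg, Matrix.mul_neg, ← Matrix.mul_assoc bᵀ, ← Matrix.mul_assoc b, hbI]
  have h4 : frobInner E V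
      = frobInner (bXᵀ * E) (bXᵀ * V) + frobInner (bᵀ * E) (bᵀ * (V - bX * (bXᵀ * V))) := by
    rw [frobInner_mul_left, frobInner_mul_left, Matrix.transpose_transpose,
      Matrix.transpose_transpose, ← h2, ← frobInner_add_right]
    congr 1
    abel
  have h5 := two_mul_frobInner_le (half_pos ha) (bᵀ * E) (bᵀ * (V - bX * (bXᵀ * V)))
  have h6 := frobSq_transpose_mul_le hbX V
  have h7 := (frobSq_transpose_mul_le hb (V - bX * (bXᵀ * V))).trans
    (frobSq_sub_projection_le hbX V)
  have h8 : (a / 2)⁻¹ = 2 * a⁻¹ := by rw [inv_div, div_eq_mul_inv]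
  rw [h8] at h1 h5
  rw [h4]
  have h9 := mul_le_mul_of_nonneg_left h6 (half_pos ha).le
  have h10 := mul_le_mul_of_nonneg_left h7 (half_pos ha).le
  linarith

/-- Deterministic control of the stochastic term. -/
theorem two_mul_frobInner_noise_le {q s : ℕ} {δ ϑ a τ lam β : ℝ} (hϑ : 0 < ϑ) (ha : 0 < a)
    (haδ : a ≤ δ / 4) (haϑ : a ≤ ϑ / 16) (hτ : τ = a * ϑ / 8) (hβ : 0 ≤ β)
    {E W C : Matrix (Fin n) (Fin m) ℝ} {bX : Matrix (Fin n) (Fin q) ℝ} (hbX : bXᵀ * bX = 1)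
    (hW : bX * (bXᵀ * W) = W) (hWs : W.rank ≤ s)
    {k : Finset (Fin n) → ℕ} {b : ∀ I, Matrix (Fin n) (Fin (k I)) ℝ}
    (hb : ∀ I, (b I)ᵀ * b I = 1)
    (hbI : ∀ I, b I * ((b I)ᵀ * (rowSelect I - bX * (bXᵀ * rowSelect I)))
      = rowSelect I - bX * (bXᵀ * rowSelect I))
    (hE : ∀ v : Fin m → ℝ, ∑ j, v j ^ 2 = 1 → ∑ i, ((bXᵀ * E) *ᵥ v) i ^ 2 ≤ β)
    {ρ : Fin n → ℝ} (hρ : ∀ i, 0 ≤ ρ i) (hEρ : ∀ i, rowNorm E i ^ 2 ≤ τ * lam ^ 2 + ρ i)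
    {g : Finset (Fin n) → ℝ} (hg : ∀ I, 0 ≤ g I)
    (hEg : ∀ I, frobSq ((b I)ᵀ * E) ≤ τ * lam ^ 2 * I.card + g I) :
    2 * frobInner E (W + C) ≤ δ / 2 * frobSq (W + C) + ϑ * pen2H C lam
      + ((a⁻¹ + 32 / ϑ) * ∑ i, ρ i + 2 * a⁻¹ * ∑ I, g I + 2 * a⁻¹ * (s * β)) := by
  classical
  set I : Finset (Fin n) := Finset.univ.filter fun i => lam ≤ rowNorm C i with hI
  have hin : ∀ i ∈ I, lam ≤ rowNorm C i := fun i hi => (Finset.mem_filter.1 hi).2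
  have hout : ∀ i ∈ Iᶜ, rowNorm C i < lam := fun i hi => by
    simpa [hI] using hi
  set R := rowSelect I with hR
  have hτ' : τ ≤ ϑ ^ 2 / 128 := by
    rw [hτ]
    nlinarith
  -- splitting of the penalty
  have hpen : pen2H C lam = I.card * (lam ^ 2 / 2) + ∑ i ∈ Iᶜ, penH (rowNorm C i) lam := by
    rw [pen2H, ← Finset.sum_add_sum_compl I, Finset.sum_congr rfl fun i hi =>
      penH_of_le (rowNorm_nonneg C i) (hin i hi), Finset.sum_const, nsmul_eq_mul]
  have hsmall : 2 * frobInner E (C - R * C)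
      ≤ ϑ / 2 * ∑ i ∈ Iᶜ, penH (rowNorm C i) lam + 32 / ϑ * ∑ i, ρ i := by
    rw [hR, frobInner_sub_rowSelect, Finset.mul_sum]
    have h1 : ∀ i ∈ Iᶜ, 2 * ∑ j, E i j * C i j
        ≤ ϑ / 2 * penH (rowNorm C i) lam + 32 / ϑ * ρ i := fun i hi =>
      (mul_le_mul_of_nonneg_left (row_inner_le E C i) zero_le_two).trans
        (two_mul_mul_le_penH hϑ (rowNorm_nonneg C i) (hout i hi) (rowNorm_nonneg E i) (hρ i)
          (hEρ i) hτ')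
    refine (Finset.sum_le_sum h1).trans ?_
    rw [Finset.sum_add_distrib, ← Finset.mul_sum, ← Finset.mul_sum]
    have h2 : ∑ i ∈ Iᶜ, ρ i ≤ ∑ i, ρ i :=
      Finset.sum_le_sum_of_subset_of_nonneg (Finset.subset_univ _) fun i _ _ => hρ i
    have h3 : 32 / ϑ * ∑ i ∈ Iᶜ, ρ i ≤ 32 / ϑ * ∑ i, ρ i := by gcongr
    linarith
  have hCsmall : frobSq (C - R * C) ≤ 2 * ∑ i ∈ Iᶜ, penH (rowNorm C i) lam := by
    rw [hR, frobSq_sub_rowSelect, Finset.mul_sum]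
    exact Finset.sum_le_sum fun i hi => sq_le_two_mul_penH (rowNorm_nonneg C i) (hout i hi)
  have hRE : frobSq (R * E) ≤ τ * lam ^ 2 * I.card + ∑ i, ρ i := by
    rw [hR, frobSq_rowSelect]
    refine (Finset.sum_le_sum fun i _ => hEρ i).trans ?_
    rw [Finset.sum_add_distrib, Finset.sum_const, nsmul_eq_mul, mul_comm]
    have h2 : ∑ i ∈ I, ρ i ≤ ∑ i, ρ i :=
      Finset.sum_le_sum_of_subset_of_nonneg (Finset.subset_univ _) fun i _ _ => hρ i
    linarith
  have hgI : g I ≤ ∑ I, g I := Finset.single_le_sum (fun I _ => hg I) (Finset.mem_univ I)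
  have hWI := two_mul_frobInner_sub_rowSelect_le ha hβ hbX hW hWs (hb I) (hbI I) hE
  rw [← hR] at hWI
  have hDI := two_mul_frobInner_le ha (R * E) (R * (W + C))
  rw [← frobInner_rowSelect_mul] at hDI
  have hD := frobSq_rowSelect_add I (W + C)
  have hWD : frobSq (W - R * W) ≤ 2 * frobSq (W + C - R * (W + C)) + 2 * frobSq (C - R * C) := by
    have h1 : W - R * W = (W + C - R * (W + C)) - (C - R * C) := by
      rw [Matrix.mul_add]; abel
    have h2 := frobSq_nonneg ((W + C - R * (W + C)) + (C - R * C))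
    rw [frobSq_add] at h2
    rw [h1, frobSq_sub]
    linarith
  have hsplit : frobInner E (W + C) = frobInner E (R * (W + C)) + frobInner E (W - R * W)
      + frobInner E (C - R * C) := by
    rw [← frobInner_add_right, ← frobInner_add_right]
    congr 1
    rw [Matrix.mul_add]; abel
  have hainv : 0 < a⁻¹ := inv_pos.2 ha
  have t1 := mul_le_mul_of_nonneg_left hRE hainv.le
  have t2 := mul_le_mul_of_nonneg_left ((hEg I).trans (add_le_add_right hgI _)) hainv.le
  -- The budget: `τ = aϑ/8` makes each unit of noise energy cost `ϑλ²|I|/8`. It is paid three times,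
  -- within the available `ϑλ²|I|/2`. Outside `I` the cost is `ϑ/2 + ϑ/4` times the penalty, and the
  -- quadratic terms use `δ/4` on `I` and `δ/2` off `I`.
  have haτ : a⁻¹ * (τ * lam ^ 2 * I.card) = ϑ / 8 * (lam ^ 2 * I.card) := by
    rw [hτ]; field_simp
  have t3 := mul_le_mul_of_nonneg_left hWD ha.le
  have t4 := mul_le_mul_of_nonneg_right haδ (frobSq_nonneg (W + C - R * (W + C)))
  have t5 := mul_le_mul_of_nonneg_right haϑ (frobSq_nonneg (C - R * C))
  have t6 := mul_le_mul_of_nonneg_right haδ (frobSq_nonneg (R * (W + C)))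
  have t7 := mul_le_mul_of_nonneg_left hCsmall hϑ.le
  have t8 : 0 ≤ ϑ * ∑ i ∈ Iᶜ, penH (rowNorm C i) lam := by
    have := frobSq_nonneg (C - R * C)
    have : 0 ≤ ∑ i ∈ Iᶜ, penH (rowNorm C i) lam := by linarith
    positivity
  have t9 : 0 ≤ ϑ * (lam ^ 2 * I.card) := by positivity
  have t10 : 0 ≤ δ * frobSq (R * (W + C)) := by
    have := frobSq_nonneg (R * (W + C))
    have : 0 ≤ δ := by linarith
    positivity
  rw [← hR] at hD
  rw [hsplit, hpen, ← hD]
  rw [mul_add, haτ] at t1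
  rw [mul_add, haτ] at t2
  linarith

end Deterministic

end RobustRRR
namespace RobustRRR

/-! ### Exponential moments of sub-Gaussian noise -/

section SubGaussian

open ENNReal

theorem lintegral_pi_ofReal_prod {κ : Type*} [Fintype κ] {ν : Measure ℝ} [SigmaFinite ν]
    {f : κ → ℝ → ℝ} (hf : ∀ k, Integrable (f k) ν) (hf0 : ∀ k x, 0 ≤ f k x) :
    ∫⁻ x : κ → ℝ, ENNReal.ofReal (∏ k, f k (x k)) ∂(Measure.pi fun _ => ν)
      = ENNReal.ofReal (∏ k, ∫ x, f k x ∂ν) := by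
  rw [← integral_fintype_prod_eq_prod (𝕜 := ℝ) (E := fun _ => ℝ) f,
    ofReal_integral_eq_lintegral_ofReal (Integrable.fintype_prod_dep (E := fun _ => ℝ) hf)
      (Filter.Eventually.of_forall fun x => Finset.prod_nonneg fun k _ => hf0 k _)]

theorem integral_exp_mul_gaussianReal (s : ℝ) :
    ∫ x, Real.exp (s * x) ∂(gaussianReal 0 1) = Real.exp (s ^ 2 / 2) := by
  have h := mgf_gaussianReal (p := gaussianReal 0 1) (X := id) (μ := 0) (v := 1) Measure.map_id s
  simpa [mgf] using h

/-- The exact value is `√2`; rounding up to 2 keeps later bounds as integer powers of 2. -/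
theorem integrable_exp_sq_div_four_gaussianReal :
    Integrable (fun x : ℝ => Real.exp (x ^ 2 / 4)) (gaussianReal 0 1) ∧
      ∫ x, Real.exp (x ^ 2 / 4) ∂(gaussianReal 0 1) ≤ 2 := by
  have hpdf : ∀ x : ℝ, gaussianPDFReal 0 1 x * Real.exp (x ^ 2 / 4)
      = (Real.sqrt (2 * Real.pi))⁻¹ * Real.exp (-(1 / 4) * x ^ 2) := by
    intro x
    rw [gaussianPDFReal]
    simp only [NNReal.coe_one, mul_one, sub_zero]
    rw [mul_assoc, ← Real.exp_add]
    congr 2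
    ring
  constructor
  · rw [gaussianReal_of_var_ne_zero _ one_ne_zero,
      integrable_withDensity_iff_integrable_smul' (measurable_gaussianPDF 0 1)
        (Filter.Eventually.of_forall fun x => by simp [gaussianPDF])]
    have : (fun x : ℝ => (gaussianPDF 0 1 x).toReal • Real.exp (x ^ 2 / 4))
        = fun x => (Real.sqrt (2 * Real.pi))⁻¹ * Real.exp (-(1 / 4) * x ^ 2) := by
      funext x
      rw [← hpdf, gaussianPDF, ENNReal.toReal_ofReal (gaussianPDFReal_nonneg _ _ _), smul_eq_mul]
    rw [this]
    exact (integrable_exp_neg_mul_sq (by norm_num)).const_mul _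
  · rw [integral_gaussianReal_eq_integral_smul one_ne_zero]
    simp only [smul_eq_mul, hpdf]
    rw [integral_const_mul, integral_gaussian, ← Real.sqrt_inv, ← Real.sqrt_mul (by positivity)]
    have : (2 * Real.pi)⁻¹ * (Real.pi / (1 / 4)) = 2 := by
      field_simp; norm_num
    rw [this]
    exact Real.sqrt_le_iff.2 ⟨by norm_num, by norm_num⟩

variable {Ω : Type*} [MeasurableSpace Ω] {μ : Measure Ω} {n m k l : ℕ} {σ : ℝ≥0}

theorem IsSubGaussianNoise.aemeasurable_frobInner {N : Ω → Matrix (Fin n) (Fin m) ℝ}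
    (hN : IsSubGaussianNoise μ N σ) (A : Matrix (Fin n) (Fin m) ℝ) :
    AEMeasurable (fun ω => frobInner (N ω) A) μ :=
  (hN A).aemeasurable

theorem frobInner_single (A : Matrix (Fin n) (Fin m) ℝ) (i : Fin n) (j : Fin m) :
    frobInner A (Matrix.single i j 1) = A i j := by
  simp [frobInner, Matrix.single_apply, ite_and]

theorem IsSubGaussianNoise.aemeasurable_apply {N : Ω → Matrix (Fin n) (Fin m) ℝ}
    (hN : IsSubGaussianNoise μ N σ) (i : Fin n) (j : Fin m) :
    AEMeasurable (fun ω => N ω i j) μ := by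
  simpa only [frobInner_single] using hN.aemeasurable_frobInner (Matrix.single i j 1)

theorem IsSubGaussianNoise.aemeasurable_frobSq {N : Ω → Matrix (Fin n) (Fin m) ℝ}
    (hN : IsSubGaussianNoise μ N σ) : AEMeasurable (fun ω => frobSq (N ω)) μ :=
  Finset.aemeasurable_fun_sum _ fun i _ => Finset.aemeasurable_fun_sum _ fun j _ =>
    (hN.aemeasurable_apply i j).pow_const 2

theorem IsSubGaussianNoise.lintegral_exp_le {N : Ω → Matrix (Fin n) (Fin m) ℝ}
    (hN : IsSubGaussianNoise μ N σ) (A : Matrix (Fin n) (Fin m) ℝ) :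
    ∫⁻ ω, ENNReal.ofReal (Real.exp (frobInner (N ω) A)) ∂μ
      ≤ ENNReal.ofReal (Real.exp (σ ^ 2 * frobSq A / 2)) := by
  have h1 := (hN A).integrable_exp_mul 1
  have h2 := (hN A).mgf_le 1
  simp only [mgf, one_mul] at h1 h2
  rw [← ofReal_integral_eq_lintegral_ofReal h1
    (Filter.Eventually.of_forall fun _ => (Real.exp_pos _).le)]
  refine ENNReal.ofReal_le_ofReal (h2.trans (le_of_eq ?_))
  simp [Real.coe_toNNReal _ (frobSq_nonneg A)]

/-- Sub-Gaussian noise stays sub-Gaussian under contractions. -/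
theorem IsSubGaussianNoise.transpose_mul_mul {N : Ω → Matrix (Fin n) (Fin m) ℝ}
    (hN : IsSubGaussianNoise μ N σ) {b : Matrix (Fin n) (Fin k) ℝ} {c : Matrix (Fin m) (Fin l) ℝ}
    (hbc : ∀ T : Matrix (Fin k) (Fin l) ℝ, frobSq (b * T * cᵀ) ≤ frobSq T) :
    IsSubGaussianNoise μ (fun ω => bᵀ * N ω * c) σ := by
  intro T
  have h := hN (b * T * cᵀ)
  have heq : (fun ω => frobInner (bᵀ * N ω * c) T) = fun ω => frobInner (N ω) (b * T * cᵀ) := by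
    funext ω
    rw [frobInner_mul_right, frobInner_mul_left, Matrix.transpose_transpose, Matrix.mul_assoc]
  rw [heq]
  refine ⟨h.integrable_exp_mul, fun t => (h.mgf_le t).trans (Real.exp_le_exp.2 ?_)⟩
  have h2 : ((σ ^ 2 * (frobSq (b * T * cᵀ)).toNNReal : ℝ≥0) : ℝ)
      ≤ ((σ ^ 2 * (frobSq T).toNNReal : ℝ≥0) : ℝ) := by
    refine NNReal.coe_le_coe.2 (mul_le_mul_right (Real.toNNReal_le_toNNReal (hbc T)) _)
  have h3 := mul_le_mul_of_nonneg_right h2 (sq_nonneg t)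
  linarith

theorem frobSq_orthonormal_mul {b : Matrix (Fin n) (Fin k) ℝ} (hb : bᵀ * b = 1)
    (T : Matrix (Fin k) (Fin m) ℝ) : frobSq (b * T) = frobSq T := by
  rw [← frobInner_self, frobInner_mul_left, ← Matrix.mul_assoc, hb, Matrix.one_mul,
    frobInner_self]

theorem IsSubGaussianNoise.transpose_mul {N : Ω → Matrix (Fin n) (Fin m) ℝ}
    (hN : IsSubGaussianNoise μ N σ) {b : Matrix (Fin n) (Fin k) ℝ} (hb : bᵀ * b = 1) :
    IsSubGaussianNoise μ (fun ω => bᵀ * N ω) σ := by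
  have := hN.transpose_mul_mul (b := b) (c := (1 : Matrix (Fin m) (Fin m) ℝ)) fun T => by
    rw [Matrix.transpose_one, Matrix.mul_one, frobSq_orthonormal_mul hb]
  simpa only [Matrix.mul_one] using this

/-- Exponential moment of the squared Frobenius norm of sub-Gaussian noise. -/
theorem IsSubGaussianNoise.lintegral_exp_frobSq_le [SFinite μ]
    {N : Ω → Matrix (Fin k) (Fin l) ℝ} (hN : IsSubGaussianNoise μ N σ) (hσ : 0 < σ) :
    ∫⁻ ω, ENNReal.ofReal (Real.exp (frobSq (N ω) / (4 * σ ^ 2))) ∂μ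
      ≤ ENNReal.ofReal (2 ^ (k * l)) := by
  have hσ' : (0 : ℝ) < σ := by exact_mod_cast hσ
  -- Gaussian decoupling: `exp(‖N‖²/(4σ²))` is the mean of `exp(s⟨N, g⟩)` over standard Gaussian
  -- `g`. After exchanging integrals, the sub-Gaussian bound leaves `exp(σ²s²‖g‖²/2) = exp(‖g‖²/4)`,
  -- which is still integrable.
  set s : ℝ := (Real.sqrt 2 * σ)⁻¹ with hs
  have hs2 : s ^ 2 = (2 * σ ^ 2 : ℝ)⁻¹ := by
    rw [hs, inv_pow, mul_pow, Real.sq_sqrt zero_le_two]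
  set π : Measure (Fin k × Fin l → ℝ) := Measure.pi fun _ => gaussianReal 0 1 with hπ
  have h1 : ∀ ω, ENNReal.ofReal (Real.exp (frobSq (N ω) / (4 * σ ^ 2)))
      = ∫⁻ g, ENNReal.ofReal (∏ q : Fin k × Fin l, Real.exp (s * N ω q.1 q.2 * g q)) ∂π := by
    intro ω
    rw [hπ, lintegral_pi_ofReal_prod (κ := Fin k × Fin l)
      (f := fun q x => Real.exp (s * N ω q.1 q.2 * x))
      (fun q => integrable_exp_mul_gaussianReal _) (fun q x => (Real.exp_pos _).le)]
    simp only [integral_exp_mul_gaussianReal, ← Real.exp_sum]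
    congr 2
    rw [Fintype.sum_prod_type, frobSq, Finset.sum_div]
    refine Finset.sum_congr rfl fun i _ => ?_
    rw [Finset.sum_div]
    refine Finset.sum_congr rfl fun j _ => ?_
    rw [mul_pow, hs2]
    field_simp
    norm_num
  simp only [h1]
  rw [lintegral_lintegral_swap]
  · have h2 : ∀ g : Fin k × Fin l → ℝ,
        ∫⁻ ω, ENNReal.ofReal (∏ q : Fin k × Fin l, Real.exp (s * N ω q.1 q.2 * g q)) ∂μ
          ≤ ENNReal.ofReal (∏ q : Fin k × Fin l, Real.exp (g q ^ 2 / 4)) := by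
      intro g
      have h3 := hN.lintegral_exp_le (Matrix.of fun i j => s * g (i, j))
      refine (le_of_eq ?_).trans (h3.trans (le_of_eq ?_))
      · refine lintegral_congr fun ω => ?_
        rw [← Real.exp_sum, Fintype.sum_prod_type]
        congr 2
        refine Finset.sum_congr rfl fun i _ => Finset.sum_congr rfl fun j _ => ?_
        rw [Matrix.of_apply]
        ring
      · rw [← Real.exp_sum, Fintype.sum_prod_type]
        congr 2
        rw [frobSq, Finset.mul_sum, Finset.sum_div]
        refine Finset.sum_congr rfl fun i _ => ?_
        rw [Finset.mul_sum, Finset.sum_div]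
        refine Finset.sum_congr rfl fun j _ => ?_
        rw [Matrix.of_apply, mul_pow, hs2]
        field_simp
        ring
    refine (lintegral_mono h2).trans ?_
    rw [hπ, lintegral_pi_ofReal_prod (f := fun _ x => Real.exp (x ^ 2 / 4))
      (fun _ => integrable_exp_sq_div_four_gaussianReal.1) (fun q x => (Real.exp_pos _).le)]
    refine ENNReal.ofReal_le_ofReal ?_
    rw [Finset.prod_const, Finset.card_univ, Fintype.card_prod, Fintype.card_fin, Fintype.card_fin]
    exact pow_le_pow_left₀ (integral_nonneg fun _ => (Real.exp_pos _).le)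
      integrable_exp_sq_div_four_gaussianReal.2 _
  · refine AEMeasurable.ennreal_ofReal (Finset.aemeasurable_fun_prod _ fun q _ => ?_)
    refine Real.measurable_exp.comp_aemeasurable ?_
    refine AEMeasurable.mul ?_ ?_
    · exact (hN.aemeasurable_apply q.1 q.2).comp_fst.const_mul s
    · exact ((measurable_pi_apply q).comp measurable_snd).aemeasurable

/-- Integrability and the integral bound from a bound on the lower Lebesgue integral. -/
theorem integrable_and_integral_le {f : Ω → ℝ} {c : ℝ} (hf : AEMeasurable f μ)
    (hf0 : ∀ ω, 0 ≤ f ω) (hc : 0 ≤ c)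
    (h : ∫⁻ ω, ENNReal.ofReal (f ω) ∂μ ≤ ENNReal.ofReal c) :
    Integrable f μ ∧ ∫ ω, f ω ∂μ ≤ c := by
  constructor
  · refine ⟨hf.aestronglyMeasurable, ?_⟩
    rw [hasFiniteIntegral_iff_ofReal (Filter.Eventually.of_forall hf0)]
    exact h.trans_lt ENNReal.ofReal_lt_top
  · rw [integral_eq_lintegral_of_nonneg_ae (Filter.Eventually.of_forall hf0)
      hf.aestronglyMeasurable]
    exact ENNReal.toReal_le_of_le_ofReal hc h

/-- The expected excess of the squared norm of sub-Gaussian noise over a level `T`. -/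
theorem IsSubGaussianNoise.exists_excess_bound [SFinite μ]
    {N : Ω → Matrix (Fin k) (Fin l) ℝ} (hN : IsSubGaussianNoise μ N σ) (hσ : 0 < σ) (T : ℝ) :
    ∃ g : Ω → ℝ, (∀ ω, 0 ≤ g ω) ∧ (∀ ω, frobSq (N ω) ≤ T + g ω) ∧ Integrable g μ ∧
      ∫ ω, g ω ∂μ ≤ 4 * σ ^ 2 * (Real.exp (-T / (4 * σ ^ 2)) * 2 ^ (k * l)) := by
  have hσ' : (0 : ℝ) < σ := by exact_mod_cast hσ
  set a : ℝ := 4 * σ ^ 2 with ha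
  have ha0 : 0 < a := by positivity
  -- From `z ≤ exp z` the excess `‖N‖² - T` is at most `a exp((‖N‖² - T)/a)`. This smooth majorant
  -- stands in for the positive part.
  refine ⟨fun ω => a * Real.exp (-T / a) * Real.exp (frobSq (N ω) / a),
    fun ω => by positivity, fun ω => ?_, ?_⟩
  · have h1 := Real.add_one_le_exp ((frobSq (N ω) - T) / a)
    have h2 := mul_le_mul_of_nonneg_left h1 ha0.le
    have h3 : a * ((frobSq (N ω) - T) / a + 1) = frobSq (N ω) - T + a := by field_simp
    rw [h3] at h2
    change frobSq (N ω) ≤ T + a * Real.exp (-T / a) * Real.exp (frobSq (N ω) / a)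
    rw [mul_assoc, ← Real.exp_add, show -T / a + frobSq (N ω) / a = (frobSq (N ω) - T) / a by ring]
    linarith
  · have hm : AEMeasurable (fun ω => Real.exp (frobSq (N ω) / a)) μ :=
      Real.measurable_exp.comp_aemeasurable (hN.aemeasurable_frobSq.div_const a)
    have := integrable_and_integral_le hm (fun ω => (Real.exp_pos _).le) (by positivity)
      (hN.lintegral_exp_frobSq_le hσ)
    refine ⟨this.1.const_mul _, ?_⟩
    rw [integral_const_mul, ← mul_assoc a]
    exact mul_le_mul_of_nonneg_left this.2 (by positivity)

end SubGaussian

end RobustRRR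
namespace RobustRRR

/-! ### Operator norm of sub-Gaussian noise -/

section OperatorNorm

open ENNReal

/-- Averaging a midpoint-convex function over the unit ball. -/
theorem mul_volume_ball_le_of_midpoint_convex {m : ℕ} {f : EuclideanSpace ℝ (Fin m) → ℝ≥0∞}
    (hf : Measurable f) (hconv : ∀ a b, 2 * f a ≤ f (a + b) + f (a - b))
    {v : EuclideanSpace ℝ (Fin m)} (hv : ‖v‖ ≤ 1 / 2) :
    f v * volume (Metric.ball (0 : EuclideanSpace ℝ (Fin m)) 1)
      ≤ 2 ^ m * ∫⁻ u in Metric.ball 0 1, f u := by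
  set B := Metric.ball (0 : EuclideanSpace ℝ (Fin m)) 1 with hB
  set B' := Metric.ball (0 : EuclideanSpace ℝ (Fin m)) (1 / 2) with hB'
  set g := B.indicator f with hg
  have hgm : Measurable g := hf.indicator measurableSet_ball
  have h0 : ∫⁻ u in B, f u = ∫⁻ u, g u := (lintegral_indicator measurableSet_ball f).symm
  have h1 : ∫⁻ h, g (v + h) = ∫⁻ u, g u := lintegral_add_left_eq_self g v
  have h2 : ∫⁻ h, g (v - h) = ∫⁻ u, g u := lintegral_sub_left_eq_self g v
  -- The ball of radius 1/2 about `v` stays inside the unit ball, so midpoint convexity can be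
  -- integrated over it; halving the radius costs the factor `2 ^ m`.
  have h3 : ∫⁻ h, B'.indicator (fun _ => 2 * f v) h ≤ ∫⁻ h, (g (v + h) + g (v - h)) := by
    refine lintegral_mono fun h => ?_
    by_cases hh : h ∈ B'
    · rw [Set.indicator_of_mem hh]
      have hn : ‖h‖ < 1 / 2 := by simpa [hB'] using hh
      have m1 : v + h ∈ B := by
        rw [hB, mem_ball_zero_iff]
        exact (norm_add_le _ _).trans_lt (by linarith)
      have m2 : v - h ∈ B := by
        rw [hB, mem_ball_zero_iff]
        exact (norm_sub_le _ _).trans_lt (by linarith)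
      simp only [hg, Set.indicator_of_mem m1, Set.indicator_of_mem m2]
      exact hconv v h
    · rw [Set.indicator_of_notMem hh]
      exact zero_le
  rw [lintegral_indicator measurableSet_ball, setLIntegral_const,
    lintegral_add_left (f := fun h => g (v + h)) (hgm.comp (measurable_const_add v)), h1, h2, ← two_mul, mul_assoc,
    ENNReal.mul_le_mul_iff_right two_ne_zero ofNat_ne_top, ← h0] at h3
  have h4 : volume B' = ENNReal.ofReal ((1 / 2) ^ m) * volume B := by
    rw [hB', Measure.addHaar_ball_of_pos _ _ (by norm_num : (0 : ℝ) < 1 / 2),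
      finrank_euclideanSpace_fin]
  have h5 : (2 : ℝ≥0∞) ^ m * ENNReal.ofReal ((1 / 2) ^ m) = 1 := by
    rw [← ENNReal.ofReal_ofNat 2, ← ENNReal.ofReal_pow zero_le_two, ← ENNReal.ofReal_mul
      (by positivity), ← mul_pow]
    norm_num
  calc f v * volume B = 2 ^ m * (f v * volume B') := by
        rw [h4, mul_left_comm (f v), ← mul_assoc, h5, one_mul]
    _ ≤ 2 ^ m * ∫⁻ u in B, f u := by gcongr

theorem two_mul_exp_le_exp_add_exp {x y z : ℝ} (h : 2 * z ≤ x + y) :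
    2 * Real.exp z ≤ Real.exp x + Real.exp y := by
  have h1 : Real.exp z ≤ Real.exp (x / 2) * Real.exp (y / 2) := by
    rw [← Real.exp_add]
    exact Real.exp_le_exp.2 (by linarith)
  have h2 : Real.exp x = Real.exp (x / 2) ^ 2 := by rw [← Real.exp_nat_mul]; congr 1; push_cast; ring
  have h3 : Real.exp y = Real.exp (y / 2) ^ 2 := by rw [← Real.exp_nat_mul]; congr 1; push_cast; ring
  rw [h2, h3]
  nlinarith [sq_nonneg (Real.exp (x / 2) - Real.exp (y / 2))]

variable {Ω : Type*} [MeasurableSpace Ω] {μ : Measure Ω} {m q : ℕ} {σ : ℝ≥0}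

theorem IsSubGaussianNoise.lintegral_exp_mulVec_le [SFinite μ]
    {N : Ω → Matrix (Fin q) (Fin m) ℝ} (hN : IsSubGaussianNoise μ N σ) (hσ : 0 < σ)
    {u : Fin m → ℝ} (hu : ∑ j, u j ^ 2 ≤ 1) :
    ∫⁻ ω, ENNReal.ofReal (Real.exp ((∑ i, (N ω *ᵥ u) i ^ 2) / (4 * σ ^ 2))) ∂μ
      ≤ ENNReal.ofReal (2 ^ q) := by
  set c : Matrix (Fin m) (Fin 1) ℝ := Matrix.of fun j _ => u j with hc
  have h := hN.transpose_mul_mul (b := (1 : Matrix (Fin q) (Fin q) ℝ)) (c := c) fun T => by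
    rw [Matrix.one_mul]
    simp only [frobSq, Matrix.mul_apply, hc, Matrix.transpose_apply, Matrix.of_apply,
      Fin.sum_univ_one, mul_pow, Fin.isValue]
    refine Finset.sum_le_sum fun i _ => ?_
    rw [← Finset.mul_sum]
    exact mul_le_of_le_one_right (sq_nonneg _) hu
  have h2 := h.lintegral_exp_frobSq_le hσ
  rw [mul_one] at h2
  refine le_trans (le_of_eq (lintegral_congr fun ω => ?_)) h2
  simp [frobSq, Matrix.mul_apply, hc, Matrix.mulVec, dotProduct]

/-- A random bound for the squared operator norm of sub-Gaussian noise, with its expectation. -/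
theorem IsSubGaussianNoise.exists_opNorm_bound [IsProbabilityMeasure μ]
    {N : Ω → Matrix (Fin q) (Fin m) ℝ} (hN : IsSubGaussianNoise μ N σ) (hσ : 0 < σ) :
    ∃ β : Ω → ℝ, (∀ ω, 0 ≤ β ω) ∧
      (∀ᵐ ω ∂μ, ∀ v : Fin m → ℝ, ∑ j, v j ^ 2 = 1 → ∑ i, (N ω *ᵥ v) i ^ 2 ≤ β ω) ∧
      Integrable β μ ∧ ∫ ω, β ω ∂μ ≤ 16 * σ ^ 2 * (m + q + 1) := by
  have hσ' : (0 : ℝ) < σ := by exact_mod_cast hσ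
  set a : ℝ := 4 * σ ^ 2 with ha
  have ha0 : 0 < a := by positivity
  set F : Ω → EuclideanSpace ℝ (Fin m) → ℝ≥0∞ := fun ω u =>
    ENNReal.ofReal (Real.exp ((∑ i, (N ω *ᵥ u.ofLp) i ^ 2) / a)) with hF
  set B := Metric.ball (0 : EuclideanSpace ℝ (Fin m)) 1 with hB
  have hB0 : volume B ≠ 0 := (Metric.measure_ball_pos _ _ one_pos).ne'
  have hBt : volume B ≠ ∞ := measure_ball_lt_top.ne
  -- Averaging `exp(|N u|²/a)` over the unit ball replaces a net: the average has mean at most `2 ^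
  -- q`, and by convexity it dominates the value at every point of norm 1/2 up to `2 ^ m`. It also
  -- avoids a supremum over directions.
  set Φ : Ω → ℝ≥0∞ := fun ω => (volume B)⁻¹ * ∫⁻ u in B, F ω u with hΦ
  have hFm : AEMeasurable (Function.uncurry F) (μ.prod (volume.restrict B)) := by
    refine AEMeasurable.ennreal_ofReal (Real.measurable_exp.comp_aemeasurable ?_)
    refine AEMeasurable.div_const (Finset.aemeasurable_fun_sum _ fun i _ => ?_) a
    refine AEMeasurable.pow_const ?_ 2
    simp only [Matrix.mulVec, dotProduct]
    refine Finset.aemeasurable_fun_sum _ fun j _ => ?_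
    refine (hN.aemeasurable_apply i j).comp_fst.mul ?_
    exact Measurable.aemeasurable (by fun_prop)
  have hΦm : AEMeasurable Φ μ := (AEMeasurable.lintegral_prod_right hFm).const_mul _
  have hΦle : ∫⁻ ω, Φ ω ∂μ ≤ ENNReal.ofReal (2 ^ q) := by
    rw [hΦ, lintegral_const_mul'' _ (AEMeasurable.lintegral_prod_right hFm),
      lintegral_lintegral_swap hFm]
    have h1 : ∫⁻ u in B, ∫⁻ ω, F ω u ∂μ ≤ ∫⁻ _ in B, ENNReal.ofReal (2 ^ q) := by
      refine setLIntegral_mono measurable_const fun u hu => ?_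
      refine hN.lintegral_exp_mulVec_le hσ ?_
      have hn : ‖u‖ < 1 := by simpa [hB] using hu
      have h2 := EuclideanSpace.norm_sq_eq u
      simp only [Real.norm_eq_abs, sq_abs] at h2
      rw [← h2]
      nlinarith [norm_nonneg u]
    rw [setLIntegral_const] at h1
    calc (volume B)⁻¹ * ∫⁻ u in B, ∫⁻ ω, F ω u ∂μ
        ≤ (volume B)⁻¹ * (ENNReal.ofReal (2 ^ q) * volume B) := by gcongr
      _ = ENNReal.ofReal (2 ^ q) := by
        rw [mul_left_comm, ENNReal.inv_mul_cancel hB0 hBt, mul_one]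
  have hΦfin : ∀ᵐ ω ∂μ, Φ ω < ∞ :=
    ae_lt_top' hΦm (hΦle.trans_lt ENNReal.ofReal_lt_top).ne
  have hΦint : Integrable (fun ω => (Φ ω).toReal) μ ∧ ∫ ω, (Φ ω).toReal ∂μ ≤ 2 ^ q := by
    refine integrable_and_integral_le hΦm.ennreal_toReal (fun _ => ENNReal.toReal_nonneg)
      (by positivity) (le_trans (lintegral_mono fun ω => ENNReal.ofReal_toReal_le) hΦle)
  -- Take logarithms in `exp(|N v|²/(4a)) ≤ 2 ^ (m + q) · (Φ / 2 ^ q)` and use `log z ≤ z`; the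
  -- factor 4 comes from evaluating at `v/2`. Dividing `Φ` by `2 ^ q` makes the last term at most 1
  -- in mean.
  refine ⟨fun ω => 4 * a * (m + q + (Φ ω).toReal / 2 ^ q), fun ω => by positivity, ?_, ?_, ?_⟩
  · filter_upwards [hΦfin] with ω hω v hv
    have hkey : Real.exp ((∑ i, (N ω *ᵥ v) i ^ 2) / (4 * a)) ≤ 2 ^ m * (Φ ω).toReal := by
      set w : EuclideanSpace ℝ (Fin m) := WithLp.toLp 2 ((1 / 2 : ℝ) • v) with hw
      have hwn : ‖w‖ ≤ 1 / 2 := by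
        have h2 := EuclideanSpace.norm_sq_eq w
        simp only [Real.norm_eq_abs, sq_abs, hw, Pi.smul_apply, smul_eq_mul, mul_pow,
          ← Finset.mul_sum, hv, mul_one] at h2
        exact (sq_le_sq₀ (norm_nonneg _) (by norm_num)).1 h2.le
      have hmeas : Measurable (F ω) := by
        refine (Real.measurable_exp.comp ?_).ennreal_ofReal
        refine (Finset.measurable_fun_sum _ fun i _ => ?_).div_const a
        simp only [Matrix.mulVec, dotProduct]
        fun_prop
      have hconv : ∀ x y, 2 * F ω x ≤ F ω (x + y) + F ω (x - y) := by
        intro x y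
        simp only [hF]
        have h2 : ∀ z : ℝ, 2 * ENNReal.ofReal z = ENNReal.ofReal (2 * z) := fun z => by
          rw [ENNReal.ofReal_mul zero_le_two, ENNReal.ofReal_ofNat]
        rw [← ENNReal.ofReal_add (Real.exp_pos _).le (Real.exp_pos _).le, h2]
        refine ENNReal.ofReal_le_ofReal (two_mul_exp_le_exp_add_exp ?_)
        rw [← add_div, mul_div_assoc']
        refine div_le_div_of_nonneg_right ?_ ha0.le
        rw [← Finset.sum_add_distrib, Finset.mul_sum]
        refine Finset.sum_le_sum fun i _ => ?_
        rw [WithLp.ofLp_add, WithLp.ofLp_sub, Matrix.mulVec_add, Matrix.mulVec_sub,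
          Pi.add_apply, Pi.sub_apply]
        nlinarith [sq_nonneg ((N ω *ᵥ y.ofLp) i)]
      have h3 := mul_volume_ball_le_of_midpoint_convex hmeas hconv hwn
      have h4 : F ω w ≤ 2 ^ m * Φ ω := by
        calc F ω w = (volume B)⁻¹ * (F ω w * volume B) := by
              rw [mul_left_comm, ENNReal.inv_mul_cancel hB0 hBt, mul_one]
          _ ≤ (volume B)⁻¹ * (2 ^ m * ∫⁻ u in B, F ω u) := by gcongr
          _ = 2 ^ m * Φ ω := by rw [hΦ, mul_left_comm]
      have h5 : F ω w = ENNReal.ofReal (Real.exp ((∑ i, (N ω *ᵥ v) i ^ 2) / (4 * a))) := by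
        simp only [hF, hw, Matrix.mulVec_smul, Pi.smul_apply, smul_eq_mul, mul_pow,
          ← Finset.mul_sum]
        congr 2
        field_simp
        ring
      rw [h5] at h4
      have h6 := ENNReal.toReal_mono (ENNReal.mul_ne_top (by simp) hω.ne) h4
      rw [ENNReal.toReal_ofReal (Real.exp_pos _).le, ENNReal.toReal_mul] at h6
      simpa using h6
    set x : ℝ := (∑ i, (N ω *ᵥ v) i ^ 2) / (4 * a) with hx
    have hΦpos : 0 < (Φ ω).toReal := by
      have := (Real.exp_pos x).trans_le hkey
      exact pos_of_mul_pos_right this (by positivity)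
    have hlog : x ≤ m + q + (Φ ω).toReal / 2 ^ q := by
      have h1 : 2 ^ m * (Φ ω).toReal = 2 ^ (m + q) * ((Φ ω).toReal / 2 ^ q) := by
        rw [pow_add]; field_simp
      rw [h1] at hkey
      have h2 : (2 : ℝ) ≤ Real.exp 1 := by linarith [Real.add_one_le_exp 1]
      have h3 : (2 : ℝ) ^ (m + q) ≤ Real.exp (m + q) := by
        calc (2 : ℝ) ^ (m + q) ≤ Real.exp 1 ^ (m + q) := by gcongr
          _ = Real.exp (m + q) := by rw [← Real.exp_nat_mul]; push_cast; rw [mul_one]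
      have h4 : (Φ ω).toReal / 2 ^ q ≤ Real.exp ((Φ ω).toReal / 2 ^ q) := by
        linarith [Real.add_one_le_exp ((Φ ω).toReal / 2 ^ q)]
      rw [← Real.exp_le_exp, Real.exp_add]
      exact hkey.trans (mul_le_mul h3 h4 (by positivity) (by positivity))
    have h1 : ∑ i, (N ω *ᵥ v) i ^ 2 = 4 * a * x := by rw [hx]; field_simp
    rw [h1]
    exact mul_le_mul_of_nonneg_left hlog (by positivity)
  · exact ((integrable_const _).add (hΦint.1.div_const _)).const_mul _
  · rw [integral_const_mul, integral_add (integrable_const _) (hΦint.1.div_const _),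
      integral_const, integral_div]
    have h1 : (∫ ω, (Φ ω).toReal ∂μ) / 2 ^ q ≤ 1 := by
      rw [div_le_one (by positivity)]
      exact hΦint.2
    have h2 : (16 : ℝ) * σ ^ 2 = 4 * a := by rw [ha]; ring
    rw [h2]
    refine mul_le_mul_of_nonneg_left ?_ (by positivity)
    simpa using h1

end OperatorNorm

end RobustRRR
namespace RobustRRR

/-! ### The stochastic term and the oracle inequality -/

section Oracle

variable {Ω : Type*} [MeasurableSpace Ω] {μ : Measure Ω} {n m p : ℕ} {σ : ℝ≥0}

theorem rank_add_le {A B : Matrix (Fin n) (Fin m) ℝ} : (A + B).rank ≤ A.rank + B.rank := by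
  rw [Matrix.rank, Matrix.rank, Matrix.rank, Matrix.mulVecLin_add]
  have h : LinearMap.range (A.mulVecLin + B.mulVecLin)
      ≤ LinearMap.range A.mulVecLin ⊔ LinearMap.range B.mulVecLin := by
    rintro _ ⟨x, rfl⟩
    exact Submodule.add_mem_sup (LinearMap.mem_range_self _ x) (LinearMap.mem_range_self _ x)
  exact (Submodule.finrank_mono h).trans (Submodule.finrank_add_le_finrank_add_finrank _ _)

theorem rank_sub_le (A B : Matrix (Fin n) (Fin m) ℝ) : (A - B).rank ≤ A.rank + B.rank := by
  have h : (-B).rank ≤ B.rank := by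
    have h1 : -B = (-1 : Matrix (Fin n) (Fin n) ℝ) * B := by rw [Matrix.neg_mul, Matrix.one_mul]
    rw [h1]
    exact Matrix.rank_mul_le_right _ _
  rw [sub_eq_add_neg]
  exact rank_add_le.trans (Nat.add_le_add_left h _)

theorem natCast_mul_exp_mul_two_pow_le_one {x : ℝ} (hx : m + Real.log n ≤ x) :
    n * (Real.exp (-x) * 2 ^ m) ≤ 1 := by
  rcases Nat.eq_zero_or_pos n with rfl | hn
  · simp
  have hn' : (0 : ℝ) < n := by exact_mod_cast hn
  have h2 : (2 : ℝ) ^ m ≤ Real.exp m := by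
    calc (2 : ℝ) ^ m ≤ Real.exp 1 ^ m := by
          gcongr
          linarith [Real.add_one_le_exp 1]
      _ = Real.exp m := by rw [← Real.exp_nat_mul, mul_one]
  calc n * (Real.exp (-x) * 2 ^ m) ≤ n * (Real.exp (-x) * Real.exp m) := by gcongr
    _ = n * Real.exp (m - x) := by rw [← Real.exp_add]; ring_nf
    _ ≤ n * Real.exp (-Real.log n) := by gcongr; linarith
    _ = 1 := by rw [Real.exp_neg, Real.exp_log hn', mul_inv_cancel₀ hn'.ne']

/-- By the binomial theorem the sum is `(1 + y)^n ≤ exp(n y) ≤ e`. This is the whole price of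
uniformity over row subsets. -/
theorem sum_pow_card_le {y : ℝ} (hy : 0 ≤ y) (hny : n * y ≤ 1) :
    ∑ I : Finset (Fin n), y ^ I.card ≤ 3 := by
  have h := Fintype.sum_pow_mul_eq_add_pow (Fin n) y 1
  simp only [one_pow, mul_one, Fintype.card_fin] at h
  rw [h]
  calc (y + 1) ^ n ≤ Real.exp y ^ n := by
        gcongr
        exact Real.add_one_le_exp y
    _ = Real.exp (n * y) := by rw [← Real.exp_nat_mul]
    _ ≤ Real.exp 1 := by gcongr
    _ ≤ 3 := by linarith [Real.exp_one_lt_d9]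

/-- A random bound for the stochastic term, uniform over low-rank plus row-sparse matrices. -/
theorem IsSubGaussianNoise.exists_stochastic_bound [IsProbabilityMeasure μ]
    {E : Ω → Matrix (Fin n) (Fin m) ℝ} (hE : IsSubGaussianNoise μ E σ) (hσ : 0 < σ)
    {δ ϑ a τ lam : ℝ} (hϑ : 0 < ϑ) (ha : 0 < a) (haδ : a ≤ δ / 4) (haϑ : a ≤ ϑ / 16)
    (hτ : τ = a * ϑ / 8) (hlam : 4 * σ ^ 2 * (m + Real.log n) ≤ τ * lam ^ 2)
    (X : Matrix (Fin n) (Fin p) ℝ) (s : ℕ) :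
    ∃ R : Ω → ℝ, Integrable R μ ∧
      ∫ ω, R ω ∂μ ≤ (a⁻¹ + 32 / ϑ) * (4 * σ ^ 2) + 2 * a⁻¹ * (12 * σ ^ 2)
        + 2 * a⁻¹ * (s * (16 * σ ^ 2 * (m + X.rank + 1))) ∧
      ∀ᵐ ω ∂μ, ∀ (B : Matrix (Fin p) (Fin m) ℝ) (C : Matrix (Fin n) (Fin m) ℝ), B.rank ≤ s →
        2 * frobInner (E ω) (X * B + C)
          ≤ δ / 2 * frobSq (X * B + C) + ϑ * pen2H C lam + R ω := by
  classical
  have hσ' : (0 : ℝ) < σ := by exact_mod_cast hσ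
  obtain ⟨bX, hbX, hbXX⟩ := exists_orthonormal_basis_columns X rfl
  -- One deterministic basis per row subset: the relevant `I` depends on the random estimator, and
  -- is covered by adding the excesses `g I` over all subsets.
  have hbas := fun I : Finset (Fin n) =>
    exists_orthonormal_basis_columns (rowSelect I - bX * (bXᵀ * rowSelect I)) rfl
  choose b hb hbI using hbas
  obtain ⟨β, hβ0, hβ, hβi, hβle⟩ := (hE.transpose_mul hbX).exists_opNorm_bound hσ
  set x : ℝ := τ * lam ^ 2 / (4 * σ ^ 2) with hx
  have hxlow : m + Real.log n ≤ x := by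
    rw [hx, le_div_iff₀ (by positivity)]
    linarith
  -- `y` bounds the excess per row in units of `4σ²`. The level `τλ² ≥ 4σ²(m + log n)` beats both
  -- the moment `2 ^ m` and the number of rows, giving `n y ≤ 1`.
  set y : ℝ := Real.exp (-x) * 2 ^ m with hy
  have hy0 : 0 ≤ y := by positivity
  have hny : n * y ≤ 1 := natCast_mul_exp_mul_two_pow_le_one hxlow
  -- row excess
  have hrow : ∀ i : Fin n, ∃ ρ : Ω → ℝ, (∀ ω, 0 ≤ ρ ω) ∧
      (∀ ω, rowNorm (E ω) i ^ 2 ≤ τ * lam ^ 2 + ρ ω) ∧ Integrable ρ μ ∧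
      ∫ ω, ρ ω ∂μ ≤ 4 * σ ^ 2 * y := by
    intro i
    set e : Matrix (Fin n) (Fin 1) ℝ := Matrix.of fun i' _ => if i' = i then 1 else 0 with he
    have hee : eᵀ * e = 1 := by
      ext u v
      simp [he, Matrix.mul_apply, Matrix.one_apply, Subsingleton.elim u v]
    obtain ⟨ρ, h1, h2, h3, h4⟩ :=
      (hE.transpose_mul hee).exists_excess_bound hσ (τ * lam ^ 2)
    refine ⟨ρ, h1, fun ω => ?_, h3, h4.trans (le_of_eq ?_)⟩
    · refine (le_of_eq ?_).trans (h2 ω)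
      rw [rowNorm_sq]
      simp [frobSq, he, Matrix.mul_apply]
    · rw [hy, hx, neg_div, one_mul]
  choose ρ hρ0 hρ hρi hρle using hrow
  -- excess over the row subsets
  have hset : ∀ I : Finset (Fin n), ∃ g : Ω → ℝ, (∀ ω, 0 ≤ g ω) ∧
      (∀ ω, frobSq ((b I)ᵀ * E ω) ≤ τ * lam ^ 2 * I.card + g ω) ∧ Integrable g μ ∧
      ∫ ω, g ω ∂μ ≤ 4 * σ ^ 2 * y ^ I.card := by
    intro I
    obtain ⟨g, h1, h2, h3, h4⟩ :=
      (hE.transpose_mul (hb I)).exists_excess_bound hσ (τ * lam ^ 2 * I.card)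
    refine ⟨g, h1, h2, h3, h4.trans ?_⟩
    have hk : (rowSelect I - bX * (bXᵀ * rowSelect I)).rank ≤ I.card := by
      have : rowSelect I - bX * (bXᵀ * rowSelect I) = (1 - bX * bXᵀ) * rowSelect I := by
        rw [Matrix.sub_mul, Matrix.one_mul, Matrix.mul_assoc]
      rw [this]
      exact (Matrix.rank_mul_le_right _ _).trans (rowSelect_rank_le I)
    have hexp : Real.exp (-(τ * lam ^ 2 * I.card) / (4 * σ ^ 2)) = Real.exp (-x) ^ I.card := by
      rw [← Real.exp_nat_mul, hx]
      congr 1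
      ring
    rw [hexp, hy, mul_pow, ← pow_mul]
    have : (2 : ℝ) ^ ((rowSelect I - bX * (bXᵀ * rowSelect I)).rank * m) ≤ 2 ^ (m * I.card) := by
      refine pow_le_pow_right₀ one_le_two ?_
      rw [mul_comm m]
      exact Nat.mul_le_mul_right m hk
    gcongr
  choose g hg0 hg hgi hgle using hset
  have hρI : Integrable (fun ω => ∑ i, ρ i ω) μ := integrable_finsetSum _ fun i _ => hρi i
  have hgI : Integrable (fun ω => ∑ I, g I ω) μ := integrable_finsetSum _ fun I _ => hgi I
  have hainv : 0 < a⁻¹ := inv_pos.2 ha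
  have i1 : Integrable (fun ω => (a⁻¹ + 32 / ϑ) * ∑ i, ρ i ω) μ := hρI.const_mul _
  have i2 : Integrable (fun ω => 2 * a⁻¹ * ∑ I, g I ω) μ := hgI.const_mul _
  have i3 : Integrable (fun ω => 2 * a⁻¹ * (s * β ω)) μ := (hβi.const_mul _).const_mul _
  have i12 : Integrable (fun ω => (a⁻¹ + 32 / ϑ) * ∑ i, ρ i ω + 2 * a⁻¹ * ∑ I, g I ω) μ :=
    i1.add i2
  refine ⟨fun ω => (a⁻¹ + 32 / ϑ) * ∑ i, ρ i ω + 2 * a⁻¹ * ∑ I, g I ω + 2 * a⁻¹ * (s * β ω),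
    i12.add i3, ?_, ?_⟩
  · rw [integral_add i12 i3, integral_add i1 i2, integral_const_mul, integral_const_mul,
      integral_const_mul, integral_const_mul, integral_finsetSum _ fun i _ => hρi i,
      integral_finsetSum _ fun I _ => hgi I]
    have h1 : ∑ i, ∫ ω, ρ i ω ∂μ ≤ 4 * σ ^ 2 := by
      refine (Finset.sum_le_sum fun i _ => hρle i).trans ?_
      rw [Finset.sum_const, Finset.card_univ, Fintype.card_fin, nsmul_eq_mul, mul_left_comm]
      exact mul_le_of_le_one_right (by positivity) hny
    have h2 : ∑ I, ∫ ω, g I ω ∂μ ≤ 12 * σ ^ 2 := by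
      refine (Finset.sum_le_sum fun I _ => hgle I).trans ?_
      rw [← Finset.mul_sum]
      have := mul_le_mul_of_nonneg_left (sum_pow_card_le hy0 hny)
        (by positivity : (0 : ℝ) ≤ 4 * σ ^ 2)
      linarith
    have h3 : (0 : ℝ) ≤ a⁻¹ + 32 / ϑ := by positivity
    gcongr
  · filter_upwards [hβ] with ω hω B C hB
    have hW : bX * (bXᵀ * (X * B)) = X * B := by
      rw [← Matrix.mul_assoc bXᵀ, ← Matrix.mul_assoc bX, hbXX]
    exact two_mul_frobInner_noise_le hϑ ha haδ haϑ hτ (hβ0 ω) hbX hW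
      ((Matrix.rank_mul_le_right _ _).trans hB) hb hbI hω (fun i => hρ0 i ω) (fun i => hρ i ω)
      (fun I => hg0 I ω) (fun I => hg I ω)

end Oracle

end RobustRRR
-- The oracle inequality in expectation
theorem theorem8 (δ ϑ : ℝ) (hδ : 0 < δ) (hϑ : 0 < ϑ) :
    ∃ A₀ : ℝ, 0 < A₀ ∧ ∀ A K ζ : ℝ, A₀ ≤ A → 0 < K → 0 ≤ ζ →
    ∃ Cst : ℝ, 0 < Cst ∧
    ∀ (n p m r : ℕ) (X : Matrix (Fin n) (Fin p) ℝ)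
      (Bstar : Matrix (Fin p) (Fin m) ℝ) (Cstar : Matrix (Fin n) (Fin m) ℝ)
      (σ : ℝ≥0) (α lam : ℝ) (Θ P : ℝ → ℝ → ℝ)
      (Ω : Type*) [MeasurableSpace Ω] (μ : Measure Ω) [IsProbabilityMeasure μ]
      (E : Ω → Matrix (Fin n) (Fin m) ℝ)
      (Bhat : Ω → Matrix (Fin p) (Fin m) ℝ) (Chat : Ω → Matrix (Fin n) (Fin m) ℝ),
      0 < σ →
      IsSubGaussianNoise μ E σ →
      1 ≤ Bstar.rank →
      0 ≤ α →
      (r : ℝ) = (1 + α) * Bstar.rank →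
      lam = A * σ * Real.sqrt (m + Real.log n) →
      IsThreshold Θ →
      IsAssociatedPenalty Θ P lam →
      IsBoundedPenalty P K lam →
      (∀ i j, AEMeasurable (fun ω => Bhat ω i j) μ) →
      (∀ i j, AEMeasurable (fun ω => Chat ω i j) μ) →
      (∀ᵐ ω ∂μ,
        IsFixedPoint Θ lam X (X * Bstar + Cstar + E ω) r (Bhat ω) (Chat ω) ∧
        (Bhat ω).rank = r ∧
        ContinuousAt (multiThreshold Θ lam) (X * Bstar + Cstar + E ω - X * Bhat ω)) →
      (∀ᵐ ω ∂μ, RegularityIneq Θ lam α δ ϑ ζ X Bstar Cstar (Bhat ω) (Chat ω)) →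
      Integrable (fun ω => predError X (Bhat ω - Bstar) (Chat ω - Cstar)) μ ∧
      ∫ ω, predError X (Bhat ω - Bstar) (Chat ω - Cstar) ∂μ ≤
        Cst * ((σ : ℝ) ^ 2 * (1 + α) * (X.rank + m) * Bstar.rank
          + (σ : ℝ) ^ 2 * numNonzeroRows Cstar * m
          + (σ : ℝ) ^ 2 * numNonzeroRows Cstar * Real.log n) := by
  set a : ℝ := min (δ / 4) (ϑ / 16) with ha_def
  have ha : 0 < a := lt_min (by positivity) (by positivity)
  have haδ : a ≤ δ / 4 := min_le_left _ _
  have haϑ : a ≤ ϑ / 16 := min_le_right _ _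
  set τ : ℝ := a * ϑ / 8 with hτ_def
  have hτ : 0 < τ := by positivity
  -- `A ≥ 2/√τ` means `τA² ≥ 4`, which is exactly `4σ²(m + log n) ≤ τλ²`.
  refine ⟨2 / Real.sqrt τ, by positivity, fun A K ζ hA hK hζ => ?_⟩
  have hA0 : 0 < A := lt_of_lt_of_le (by positivity) hA
  have hτA : 4 ≤ τ * A ^ 2 := by
    have h1 : 2 ≤ A * Real.sqrt τ := by rwa [div_le_iff₀ (Real.sqrt_pos.2 hτ)] at hA
    have h2 : (2 : ℝ) ^ 2 ≤ (A * Real.sqrt τ) ^ 2 := by gcongr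
    rw [mul_pow, Real.sq_sqrt hτ.le] at h2
    linarith
  have hainv : 0 < a⁻¹ := inv_pos.2 ha
  -- `152 = 24 + 128`: the row-subset excesses give `2 · 12`, and the operator norm gives `2 · 16`
  -- times the 4 from `hs`.
  set c₁ : ℝ := 4 * (a⁻¹ + 32 / ϑ) + 152 * a⁻¹ with hc₁
  have hc₁0 : 0 < c₁ := by positivity
  set c₂ : ℝ := (2 * K + ζ / 2) * A ^ 2 with hc₂
  have hc₂0 : 0 < c₂ := by positivity
  refine ⟨2 / δ * (c₁ + c₂), by positivity, ?_⟩
  intro n p m r X Bstar Cstar σ α lam Θ P Ω _ μ _ E Bhat Chat hσ hE hrank hα hr hlam hΘ hassoc hbdd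
    hBm hCm hfix hreg
  have hσ' : (0 : ℝ) < σ := by exact_mod_cast hσ
  have hlog : 0 ≤ Real.log n := Real.log_natCast_nonneg n
  have hmn : 0 ≤ (m : ℝ) + Real.log n := by positivity
  have hlam0 : 0 ≤ lam := by rw [hlam]; positivity
  have hlam2 : lam ^ 2 = A ^ 2 * σ ^ 2 * (m + Real.log n) := by
    rw [hlam, mul_pow, mul_pow, Real.sq_sqrt hmn]
  have hlamτ : 4 * σ ^ 2 * (m + Real.log n) ≤ τ * lam ^ 2 := by
    rw [hlam2]
    have := mul_le_mul_of_nonneg_right hτA (by positivity : 0 ≤ (σ : ℝ) ^ 2 * (m + Real.log n))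
    linarith
  obtain ⟨R, hRi, hRle, hR⟩ := hE.exists_stochastic_bound hσ hϑ ha haδ haϑ hτ_def hlamτ X
    (r + Bstar.rank)
  set J : ℝ := (numNonzeroRows Cstar : ℝ) with hJ
  have hJ0 : 0 ≤ J := Nat.cast_nonneg _
  -- pointwise bound
  have hpt : ∀ᵐ ω ∂μ, predError X (Bhat ω - Bstar) (Chat ω - Cstar)
      ≤ 2 / δ * (R ω + (2 * K + ζ / 2) * lam ^ 2 * J) := by
    filter_upwards [hR, hfix, hreg] with ω h1 h2 h3
    have h4 := fixedPoint_basic_inequality hΘ hlam0 hα hrank hr h2.1 h3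
    have h5 := h1 (Bhat ω - Bstar) (Chat ω - Cstar)
      ((rank_sub_le _ _).trans (by rw [h2.2.1]))
    have h6 := pen2Theta_le_of_associated hassoc hbdd Cstar
    rw [← hJ] at h6
    rw [pen20, ← hJ] at h4
    rw [predError] at h4 ⊢
    rw [div_mul_eq_mul_div, le_div_iff₀ hδ]
    linarith
  have hbi : Integrable (fun ω => 2 / δ * (R ω + (2 * K + ζ / 2) * lam ^ 2 * J)) μ :=
    (hRi.add (integrable_const _)).const_mul _
  have hM0 : ∀ ω, 0 ≤ predError X (Bhat ω - Bstar) (Chat ω - Cstar) := fun ω => frobSq_nonneg _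
  have hMm : AEMeasurable (fun ω => predError X (Bhat ω - Bstar) (Chat ω - Cstar)) μ := by
    simp only [predError, frobSq]
    refine Finset.aemeasurable_fun_sum _ fun i _ => Finset.aemeasurable_fun_sum _ fun j _ => ?_
    have h1 : AEMeasurable (fun ω => ∑ l, X i l * (Bhat ω l j - Bstar l j)) μ :=
      Finset.aemeasurable_fun_sum _ fun l _ => ((hBm l j).sub_const _).const_mul _
    exact (h1.add ((hCm i j).sub_const (Cstar i j))).pow_const 2
  have hMi : Integrable (fun ω => predError X (Bhat ω - Bstar) (Chat ω - Cstar)) μ := by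
    refine hbi.mono' hMm.aestronglyMeasurable ?_
    filter_upwards [hpt] with ω hω
    rwa [Real.norm_of_nonneg (hM0 ω)]
  refine ⟨hMi, (integral_mono_ae hMi hbi hpt).trans ?_⟩
  rw [integral_const_mul, integral_add hRi (integrable_const _), integral_const, probReal_univ,
    one_smul, mul_assoc (2 / δ)]
  refine mul_le_mul_of_nonneg_left ?_ (by positivity)
  -- comparison with the rate
  set q : ℝ := (X.rank : ℝ) with hq
  have hq0 : 0 ≤ q := Nat.cast_nonneg _
  have hr1 : (1 : ℝ) ≤ Bstar.rank := by exact_mod_cast hrank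
  -- A matrix `B*` of rank at least 1 has a column, and `m ≥ 1` lets the additive constants be
  -- absorbed into `q + m`.
  have hm1 : (1 : ℝ) ≤ m := by
    have : Bstar.rank ≤ m := Bstar.rank_le_width
    exact_mod_cast hrank.trans this
  set G : ℝ := (1 + α) * (q + m) * Bstar.rank with hG
  have hs : (((r + Bstar.rank : ℕ) : ℝ)) * (m + q + 1) ≤ 4 * G := by
    push_cast
    rw [hr, hG]
    have h1 : (1 + α) * Bstar.rank + Bstar.rank ≤ 2 * ((1 + α) * (Bstar.rank : ℝ)) := by
      nlinarith
    have h2 : (m : ℝ) + q + 1 ≤ 2 * (q + m) := by linarith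
    calc ((1 + α) * Bstar.rank + Bstar.rank) * (m + q + 1)
        ≤ 2 * ((1 + α) * Bstar.rank) * (2 * (q + m)) := by gcongr
      _ = 4 * ((1 + α) * (q + m) * Bstar.rank) := by ring
  have hG1 : 1 ≤ G := by
    have h1 : (1 : ℝ) ≤ 1 + α := by linarith
    have h2 : 1 ≤ q + m := by linarith
    exact one_le_mul_of_one_le_of_one_le (one_le_mul_of_one_le_of_one_le h1 h2) hr1
  have hRG : ∫ ω, R ω ∂μ ≤ c₁ * (σ ^ 2 * G) := by
    refine hRle.trans ?_
    have e1 : (σ : ℝ) ^ 2 ≤ σ ^ 2 * G := le_mul_of_one_le_right (by positivity) hG1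
    have e2 := mul_le_mul_of_nonneg_left e1 (by positivity : 0 ≤ (a⁻¹ + 32 / ϑ) * 4 + 24 * a⁻¹)
    have e3 := mul_le_mul_of_nonneg_left hs (by positivity : 0 ≤ 32 * a⁻¹ * (σ : ℝ) ^ 2)
    rw [hc₁]
    linarith
  have hσG : 0 ≤ (σ : ℝ) ^ 2 * G := by positivity
  have hJσ : 0 ≤ (σ : ℝ) ^ 2 * J * m + σ ^ 2 * J * Real.log n := by positivity
  have hfin : (2 * K + ζ / 2) * lam ^ 2 * J
      = c₂ * ((σ : ℝ) ^ 2 * J * m + σ ^ 2 * J * Real.log n) := by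
    rw [hlam2, hc₂]; ring
  have hGeq : (σ : ℝ) ^ 2 * (1 + α) * (q + m) * Bstar.rank = σ ^ 2 * G := by rw [hG]; ring
  rw [hfin, hGeq]
  have t1 := mul_nonneg hc₁0.le hJσ
  have t2 := mul_nonneg hc₂0.le hσG
  linarith
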